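/- Work with sequences in $\{0,1\}^{\mathbb N}$. An \emph{Oracle-Type-2-Machine} $M$ is a finite labelled directed graph operating an input tape, two working tapes and an output tape (all over $\{0,1\}$, infinite to one side, initially $0^{\mathbb N}$ except for the input tape). Its vertices are: one start vertex without incoming edges; tests of the current cell of the input tape or of a working tape; head moves to the left or right on these tapes; writing a bit on a working tape or on the output tape and moving right; accept; reject; and query vertices $?$ with two successors. It yields an output either by accepting (the output is then the whole output tape) or by writing infinitely many output symbols. For an oracle $\mathcal O$, query depth $0$ means that $?$-vertices act like reject. With query depth $n+1$, at a $?$-vertex a copy of the current configuration with erased output tape is started at the second successor and run with query depth $n$ (or less). If it yields $x$ and $y\in\mathcal O(x)$, the main computation continues at the first successor, with $y$ on the second working tape and the head of that tape at position $0$. Let $F_n(x)$ be the set of outputs of $M$ on input $x$ with query depth $n$. A \emph{Type-2-Machine} is such a machine without $?$-vertices. Let $LPO(0^{\mathbb N})=0^{\mathbb N}$ and $LPO(w)=10^{\mathbb N}$ for $w\neq 0^{\mathbb N}$. A partial (multi-valued) function $F$ on $\{0,1\}^{\mathbb N}$ is \emph{computable by finitely revising computation} if there is a Type-2-Machine $R$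 with output alphabet $\{0,1,\#\}$ (encoded in binary by two-bit blocks, $0b$ for the bit $b$, and $10$, $11$ for the revising mark $\#$) such that for all $x,y$: $y\in F(x)$ if and only if $R$ on input $x$ yields a sequence that contains only finitely many marks and whose part after the last mark is $y$. \textbf{Theorem.} Let $M$ be an Oracle-Type-2-Machine with oracle $LPO$, and let $n\in\mathbb N$. Let $A$ be the set of those inputs on which $M$, with query depth $n$, makes only finitely many oracle calls in total (calls at the top level, and calls nested in the computation of queries). Then the restriction of $F_n$ to $A$ (undefined outside $A$) is computable by finitely revising computation. In particular, if $M$ makes only finitely many oracle calls on every input on which it yields an output, then $F_n$ itself is computable by finitely revising computation. -/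

import Mathlib

open Filter

/-- Infinite binary sequences. -/
abbrev BinSeq : Type := ℕ → Bool

/-- The sequence `0^ℕ`. -/
def zeroSeq : BinSeq := fun _ => false

/-- The sequence `1 0^ℕ`. -/
def oneZeroSeq : BinSeq := fun k => decide (k = 0)

open Classical in
/-- The omniscience principle `LPO`. -/
noncomputable def LPO (w : BinSeq) : BinSeq :=
  if w = zeroSeq then zeroSeq else oneZeroSeq

/-! ### Machines -/

/-- The label of a vertex together with its outgoing edges. The readable tapes are `0` (input tape),
`1` and `2` (working tapes); `write i b` writes on the working tape with number `i + 1`. -/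
inductive Instr (V : Type) : Type
  /-- the label `s` -/
  | start (next : V)
  /-- the label `t_i`; the first successor is taken on `0`, the second one on `1` -/
  | test (i : Fin 3) (succ₀ succ₁ : V)
  /-- the label `l_i` -/
  | left (i : Fin 3) (next : V)
  /-- the label `r_i` -/
  | right (i : Fin 3) (next : V)
  /-- the labels `w_1^b` and `w_2^b` -/
  | write (i : Fin 2) (b : Bool) (next : V)
  /-- the label `w_3^b` (output tape) -/
  | writeOut (b : Bool) (next : V)
  /-- the label `?`; the computation proper continues at `succ₀`, while the spawned copy that computes
  the oracle query starts at `succ₁` -/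
  | query (succ₀ succ₁ : V)
  /-- the label `a` -/
  | accept
  /-- the label `r` -/
  | reject

/-- The targets of the outgoing edges. -/
def Instr.successors {V : Type} : Instr V → List V
  | .start v => [v]
  | .test _ u v => [u, v]
  | .left _ v => [v]
  | .right _ v => [v]
  | .write _ _ v => [v]
  | .writeOut _ v => [v]
  | .query u v => [u, v]
  | .accept => []
  | .reject => []

/-- An Oracle-Type-2-Machine: a finite labelled directed graph in which exactly one vertex carries
the label `s`, and that vertex is a source. -/
structure OracleMachine : Type 1 where
  V : Type
  finite : Finite V
  node : V → Instr V
  start : V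
  node_start : ∀ v, (∃ u, node v = .start u) ↔ v = start
  start_source : ∀ v, start ∉ (node v).successors

/-- A configuration `(q, w₀, n₀, w₁, n₁, w₂, n₂, w₃, n₃)`: `tape i = wᵢ` and `head i = nᵢ` for
`i = 0, 1, 2`, and `out = w₃`, `outHead = n₃` for the output tape. -/
@[ext]
structure Config (V : Type) : Type where
  q : V
  tape : Fin 3 → BinSeq
  head : Fin 3 → ℕ
  out : BinSeq
  outHead : ℕ

namespace OracleMachine

variable (M : OracleMachine)

/-- A Type-2-Machine is a machine in which the label `?` does not occur. -/
def IsType2 : Prop := ∀ v u₀ u₁, M.node v ≠ .query u₀ u₁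

/-- The initial configuration on input `x`. -/
def init (x : BinSeq) : Config M.V where
  q := M.start
  tape := fun i => if i = 0 then x else zeroSeq
  head := fun _ => 0
  out := zeroSeq
  outHead := 0

/-- The successor configuration at a vertex whose label is not `?`, if there is one. -/
def next (c : Config M.V) : Option (Config M.V) :=
  match M.node c.q with
  | .start v => some { c with q := v }
  | .test i u v => some { c with q := if c.tape i (c.head i) = true then v else u }
  | .left i v =>
      if c.head i = 0 then none
      else some { c with q := v, head := Function.update c.head i (c.head i - 1) }
  | .right i v => some { c with q := v, head := Function.update c.head i (c.head i + 1) }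
  | .write i b v =>
      some { c with
        q := v
        tape := Function.update c.tape i.succ
          (Function.update (c.tape i.succ) (c.head i.succ) b)
        head := Function.update c.head i.succ (c.head i.succ + 1) }
  | .writeOut b v =>
      some { c with
        q := v
        out := Function.update c.out c.outHead b
        outHead := c.outHead + 1 }
  | .query _ _ => none
  | .accept => none
  | .reject => none

/-- The transition relation of ordinary Type-2-Machines. -/
def PlainStep (c c' : Config M.V) : Prop := M.next c = some c'

/-- Configuration `c` yields the output `w`, given the single step relation `T`: either an accepting
configuration with output tape `w` is reachable, or for every `m ≥ n₃` a configuration with output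
head at position `m` is reachable, and the output tapes of these configurations converge to `w`. -/
def Yields (T : Config M.V → Config M.V → Prop) (c : Config M.V) (w : BinSeq) : Prop :=
  (∃ c', Relation.ReflTransGen T c c' ∧ M.node c'.q = .accept ∧ c'.out = w) ∨
  (∃ d : ℕ → Config M.V,
    (∀ m, c.outHead ≤ m → Relation.ReflTransGen T c (d m) ∧ (d m).outHead = m) ∧
    ∀ k, ∀ᶠ m in atTop, (d m).out k = w k)

/-- The configuration in which the copy computing an oracle query is spawned. -/
def spawn (c : Config M.V) (v : M.V) : Config M.V :=
  { c with q := v, out := zeroSeq, outHead := 0 }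

/-- The configuration after the oracle answer `y` has been received. -/
def receive (c : Config M.V) (v : M.V) (y : BinSeq) : Config M.V :=
  { c with q := v, tape := Function.update c.tape 2 y, head := Function.update c.head 2 0 }

/-- The transition relation with query depth `n` and oracle `O`, a partial multi-valued function
given by its sets of values. -/
def Step (O : BinSeq → Set BinSeq) : ℕ → Config M.V → Config M.V → Prop
  | 0 => M.PlainStep
  | n + 1 => fun c c' =>
      Step O n c c' ∨
      ∃ v₀ v₁ x y, M.node c.q = .query v₀ v₁ ∧ M.Yields (Step O n) (M.spawn c v₁) x ∧ y ∈ O x ∧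
        c' = M.receive c v₀ y

/-- The multi-valued function computed by a machine with oracle `O` and query depth `n`. -/
def depthFun (O : BinSeq → Set BinSeq) (n : ℕ) (x : BinSeq) : Set BinSeq :=
  {y | M.Yields (M.Step O n) (M.init x) y}

/-- The (multi-valued) function computed by a machine as an ordinary Type-2-Machine. -/
def type2Fun (x : BinSeq) : Set BinSeq :=
  {y | M.Yields M.PlainStep (M.init x) y}

/-- `CountedRun O n c c' k`: with query depth `n`, there is a run from `c` to `c'` in which exactly
`k` oracle calls are made at the top level of nesting. -/
inductive CountedRun (O : BinSeq → Set BinSeq) (n : ℕ) (c : Config M.V) :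
    Config M.V → ℕ → Prop
  | refl : CountedRun O n c c 0
  | plain {c' c'' : Config M.V} {k : ℕ} : CountedRun O n c c' k →
      (∀ v₀ v₁, M.node c'.q ≠ .query v₀ v₁) → M.Step O n c' c'' → CountedRun O n c c'' k
  | call {c' c'' : Config M.V} {k : ℕ} : CountedRun O n c c' k →
      (∃ v₀ v₁, M.node c'.q = .query v₀ v₁) → M.Step O n c' c'' → CountedRun O n c c'' (k + 1)

/-- Started in `c` with query depth `n`, the machine makes only finitely many oracle calls in total:
finitely many at the top level, and, recursively, finitely many in the computation of each of the
queries that are posed. With query depth `0` no call is ever made. -/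
def FinitelyManyCallsFrom (O : BinSeq → Set BinSeq) : ℕ → Config M.V → Prop
  | 0 => fun _ => True
  | n + 1 => fun c =>
      (∃ N, ∀ c' k, M.CountedRun O (n + 1) c c' k → k ≤ N) ∧
      ∀ c' v₀ v₁, Relation.ReflTransGen (M.Step O (n + 1)) c c' → M.node c'.q = .query v₀ v₁ →
        FinitelyManyCallsFrom O n (M.spawn c' v₁)

/-- On input `x`, the machine with oracle `O` and query depth `n` makes only finitely many oracle
calls in total. -/
def FinitelyManyCalls (O : BinSeq → Set BinSeq) (n : ℕ) (x : BinSeq) : Prop :=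
  M.FinitelyManyCallsFrom O n (M.init x)

end OracleMachine

/-! ### Finitely revising computation -/

/-- Binary encoding of sequences over `{0, 1, #}`, where `#` (here `none`) is the revising mark: the
block `0b` encodes the symbol `b`, and a block `1b` encodes the mark. -/
def decodeMarks (z : BinSeq) : ℕ → Option Bool :=
  fun k => if z (2 * k) = true then none else some (z (2 * k + 1))

/-- `z` is a finitely revising name of `y`: the sequence over `{0, 1, #}` encoded by `z` contains
only finitely many marks, and what follows the last mark is `y`. -/
def IsRevisingName (z y : BinSeq) : Prop :=
  ∃ m, (∀ k, decodeMarks z (m + k) = some (y k)) ∧ ∀ j, m = j + 1 → decodeMarks z j = none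

/-- `F` is the partial (multi-valued) function computed by a finitely revising computation: some
Type-2-Machine produces, on each input `x`, a finitely revising name exactly of the values of `F`
at `x` (and no such name if `F x` is empty). -/
def FinitelyRevisingComputable (F : BinSeq → Set BinSeq) : Prop :=
  ∃ R : OracleMachine, R.IsType2 ∧
    ∀ x, F x = {y | ∃ z ∈ R.type2Fun x, IsRevisingName z y}

/-! Fix a step budget `s`. Run `M` for `s` steps and answer every query by running its spawned copy
for `s` steps as well, recursively down to depth `0`: guess `10^ℕ` if that copy has written a `1`,
and `0^ℕ` otherwise. Two further items are recorded (`simStep`, `simResult`): a log of all calls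
with their guessed answers, nested calls included, and the progress, which is the minimum, over the
computation and all queries inside it, of the number of output symbols written (or the budget, after
acceptance). The revising machine works with growing budgets. It prints a mark whenever the log
changes; otherwise it prints the next bit of the current approximation, provided that the progress
exceeds the number of bits printed since the last mark.

If `M` yields an output with finitely many calls, each of the finitely many guesses is right for
large `s`, so the log stabilizes and the progress tends to infinity (`eventually_sim`). Conversely,
suppose that the log is stable and the progress unbounded (`sim_correct`). By induction on the depth
and along the run, every guess is independent of `s`; progress shows that the query really yields an
output; and a constant guess that is eventually right is right throughout. Hence all approximations
with the stable log follow the true run, and the length of the log bounds the number of calls. This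
retrospective correctness is essential, since bits printed just after the last mark are never
revised. Progress is what excludes a query that stalls without yielding: its guess would be stable,
but the printing stops. `RevisingOutput` turns these facts into statements on names.

It remains to build the machine. For fixed depth the approximation is a primitive recursive function
of a finite input prefix (`describes_sim`, `primrec_sim`). Any primitive recursive stage function is
performed by a Type-2-Machine (`exists_revising_stageMachine`): the two working tapes act as
counters, one counter codes finitely many registers as exponents of primes, and register programs
compute all primitive recursive functions (`computes_of_primrec'`). -/

/-! ### Flowcharts over two counters -/

/-- Relabelling the targets of the outgoing edges. -/
def Instr.map {V W : Type} (f : V → W) : Instr V → Instr W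
  | .start v => .start (f v)
  | .test i u v => .test i (f u) (f v)
  | .left i v => .left i (f v)
  | .right i v => .right i (f v)
  | .write i b v => .write i b (f v)
  | .writeOut b v => .writeOut b (f v)
  | .query u v => .query (f u) (f v)
  | .accept => .accept
  | .reject => .reject

theorem Instr.map_map {V W X : Type} (f : V → W) (g : W → X) (a : Instr V) :
    (a.map f).map g = a.map (g ∘ f) := by cases a <;> rfl

/-- The labels other than `s` and `?`. -/
def Instr.Plain {V : Type} : Instr V → Prop
  | .start _ => False
  | .query _ _ => False
  | _ => True

theorem Instr.Plain.map {V W : Type} (f : V → W) {a : Instr V} (h : a.Plain) :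
    (a.map f).Plain := by cases a <;> exact h

theorem Instr.mem_successors_map {V W : Type} {f : V → W} {a : Instr V} {w : W}
    (h : w ∈ (a.map f).successors) : ∃ v, w = f v := by
  cases a <;> simp only [Instr.map, Instr.successors, List.mem_cons, List.not_mem_nil, or_false]
    at h <;> first | exact ⟨_, h⟩ | (rcases h with h | h <;> exact ⟨_, h⟩)

/-- A configuration without its vertex, in which both working tapes are `1 0^ℕ` and are used as
counters: their contents are the positions `a` and `b` of the heads. -/
structure CounterState : Type where
  input : BinSeq
  pos : ℕ
  a : ℕ
  b : ℕ
  out : BinSeq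
  outHead : ℕ

namespace CounterState

def toConfig {V : Type} (s : CounterState) (q : V) : Config V where
  q := q
  tape := ![s.input, oneZeroSeq, oneZeroSeq]
  head := ![s.pos, s.a, s.b]
  out := s.out
  outHead := s.outHead

/-- The state after writing the symbol `b` on the output tape. -/
def emit (s : CounterState) (b : Bool) : CounterState :=
  { s with out := Function.update s.out s.outHead b, outHead := s.outHead + 1 }

end CounterState

/-- The relation `R` between states, with exits labelled by `E`, is realized by a flowchart: wherever
it is embedded in a machine, the machine runs from the entry to the exit `e` as given by `R`. -/
def Realizable {E : Type} (R : CounterState → E → CounterState → Prop) : Prop :=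
  ∃ (W : Type) (_ : Finite W) (entry : W) (node : W → Instr (W ⊕ E)),
    (∀ w, (node w).Plain) ∧
    ∀ (M : OracleMachine) (φ : W ⊕ E → M.V), (∀ w, M.node (φ (.inl w)) = (node w).map φ) →
      ∀ s e s', R s e s' →
        Relation.TransGen M.PlainStep (s.toConfig (φ (.inl entry))) (s'.toConfig (φ (.inr e)))

namespace Realizable

theorem mono {E : Type} {R R' : CounterState → E → CounterState → Prop} (h : Realizable R)
    (hR : ∀ s e s', R' s e s' → R s e s') : Realizable R' := by
  obtain ⟨W, hW, w, node, hp, H⟩ := h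
  exact ⟨W, hW, w, node, hp, fun M φ hφ s e s' h => H M φ hφ s e s' (hR s e s' h)⟩

/-- The composite graph contains one copy of a second flowchart for each exit `e` of the first, with
that exit redirected to its entry; finiteness of `E` keeps the graph finite. -/
theorem bind {E E' : Type} [Finite E] {R : CounterState → E → CounterState → Prop}
    {R' : E → CounterState → E' → CounterState → Prop} (h : Realizable R)
    (h' : ∀ e, Realizable (R' e)) :
    Realizable (fun s e' s' => ∃ e s₁, R s e s₁ ∧ R' e s₁ e' s') := by
  obtain ⟨W, hW, entry, node, hp, H⟩ := h
  choose W' hW' entry' node' hp' H' using h'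
  refine ⟨W ⊕ (Σ e, W' e), inferInstance, .inl entry,
    Sum.elim
      (fun w => (node w).map
        (Sum.elim (fun w => .inl (.inl w)) (fun e => .inl (.inr ⟨e, entry' e⟩))))
      (fun w => (node' w.1 w.2).map (Sum.elim (fun u => .inl (.inr ⟨w.1, u⟩)) .inr)), ?_, ?_⟩
  · rintro (w | w)
    · exact (hp w).map _
    · exact (hp' _ _).map _
  · intro M φ hφ s e' s' ⟨e, s₁, h₁, h₂⟩
    have A := H M (φ ∘ Sum.elim (fun w => .inl (.inl w)) (fun e => .inl (.inr ⟨e, entry' e⟩)))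
      (fun w => by
        have := hφ (.inl w)
        simpa [Instr.map_map] using this) s e s₁ h₁
    have B := H' e M (φ ∘ Sum.elim (fun u => .inl (.inr ⟨e, u⟩)) .inr)
      (fun w => by
        have := hφ (.inr ⟨e, w⟩)
        simpa [Instr.map_map] using this) s₁ e' s' h₂
    exact A.trans B

/-- Iteration of a relation as long as it takes the exit `none`. -/
inductive Loop {E : Type} (R : CounterState → Option E → CounterState → Prop) :
    CounterState → E → CounterState → Prop
  | finish {s e s'} : R s (some e) s' → Loop R s e s'
  | again {s s₁ e s'} : R s none s₁ → Loop R s₁ e s' → Loop R s e s'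

/-- Only the edges change: the exit `none` is redirected to the entry. -/
theorem loop {E : Type} {R : CounterState → Option E → CounterState → Prop} (h : Realizable R) :
    Realizable (Loop R) := by
  obtain ⟨W, hW, entry, node, hp, H⟩ := h
  refine ⟨W, hW, entry, fun w => (node w).map
    (Sum.elim .inl (fun o => o.elim (.inl entry) .inr)), fun w => (hp w).map _, ?_⟩
  intro M φ hφ s e s' h
  have A := H M (φ ∘ Sum.elim .inl (fun o => o.elim (.inl entry) .inr))
    (fun w => by
      have := hφ w
      simpa [Instr.map_map] using this)
  induction h with
  | finish h => exact A _ _ _ h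
  | again h _ ih => exact (A _ _ _ h).trans ih

/-! ### Flowcharts consisting of one instruction -/

theorem single {E : Type} {R : CounterState → E → CounterState → Prop} (a : Instr E)
    (ha : a.Plain)
    (H : ∀ (M : OracleMachine) (q : M.V) (φ : E → M.V), M.node q = a.map φ →
      ∀ s e s', R s e s' → M.next (s.toConfig q) = some (s'.toConfig (φ e))) :
    Realizable R := by
  refine ⟨Unit, inferInstance, (), fun _ => a.map .inr, fun _ => ha.map _, ?_⟩
  intro M φ hφ s e s' h
  refine .single (H M _ (φ ∘ .inr) ?_ s e s' h)
  rw [hφ (), Instr.map_map]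

theorem testInput : Realizable (fun s e s' => e = s.input s.pos ∧ s' = s) := by
  refine single (.test 0 false true) trivial ?_
  rintro M q φ hq s e s' ⟨rfl, rfl⟩
  simp only [OracleMachine.next, CounterState.toConfig, hq, Instr.map]
  cases h : s'.input s'.pos <;> simp [h]

/-- The only `1` on the tape `1 0^ℕ` is in cell `0`, so testing the current cell is a zero test for
the counter. -/
theorem testA : Realizable (fun s e s' => e = decide (s.a = 0) ∧ s' = s) := by
  refine single (.test 1 false true) trivial ?_
  rintro M q φ hq s e s' ⟨rfl, rfl⟩
  simp only [OracleMachine.next, CounterState.toConfig, hq, Instr.map]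
  by_cases h : s'.a = 0 <;> simp [h, oneZeroSeq]

theorem testB : Realizable (fun s e s' => e = decide (s.b = 0) ∧ s' = s) := by
  refine single (.test 2 false true) trivial ?_
  rintro M q φ hq s e s' ⟨rfl, rfl⟩
  simp only [OracleMachine.next, CounterState.toConfig, hq, Instr.map]
  by_cases h : s'.b = 0 <;> simp [h, oneZeroSeq]

/-- A test with equal successors serves as an instruction without effect; it supplies the at least
one step that `Realizable` demands. -/
theorem skip {E : Type} (e₀ : E) : Realizable (fun s e s' => e = e₀ ∧ s' = s) := by
  refine single (.test 1 e₀ e₀) trivial ?_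
  rintro M q φ hq s e s' ⟨rfl, rfl⟩
  simp [OracleMachine.next, CounterState.toConfig, hq, Instr.map]

theorem advance : Realizable (fun s (_ : Unit) s' => s' = { s with pos := s.pos + 1 }) := by
  refine single (.right 0 ()) trivial ?_
  rintro M q φ hq s e s' rfl
  simp only [OracleMachine.next, CounterState.toConfig, hq, Instr.map]
  congr 2
  funext i; fin_cases i <;> simp

theorem incA : Realizable (fun s (_ : Unit) s' => s' = { s with a := s.a + 1 }) := by
  refine single (.right 1 ()) trivial ?_
  rintro M q φ hq s e s' rfl
  simp only [OracleMachine.next, CounterState.toConfig, hq, Instr.map]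
  congr 2
  funext i; fin_cases i <;> simp [Function.update]

theorem incB : Realizable (fun s (_ : Unit) s' => s' = { s with b := s.b + 1 }) := by
  refine single (.right 2 ()) trivial ?_
  rintro M q φ hq s e s' rfl
  simp only [OracleMachine.next, CounterState.toConfig, hq, Instr.map]
  congr 2
  funext i; fin_cases i <;> simp [Function.update]

theorem decA : Realizable (fun s (_ : Unit) s' => s.a ≠ 0 ∧ s' = { s with a := s.a - 1 }) := by
  refine single (.left 1 ()) trivial ?_
  rintro M q φ hq s e s' ⟨h, rfl⟩
  have h' : ¬ (![s.pos, s.a, s.b] : Fin 3 → ℕ) 1 = 0 := h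
  simp only [OracleMachine.next, CounterState.toConfig, hq, Instr.map]
  refine (if_neg h').trans ?_
  congr 2
  funext i; fin_cases i <;> simp [Function.update]

theorem decB : Realizable (fun s (_ : Unit) s' => s.b ≠ 0 ∧ s' = { s with b := s.b - 1 }) := by
  refine single (.left 2 ()) trivial ?_
  rintro M q φ hq s e s' ⟨h, rfl⟩
  have h' : ¬ (![s.pos, s.a, s.b] : Fin 3 → ℕ) 2 = 0 := h
  simp only [OracleMachine.next, CounterState.toConfig, hq, Instr.map]
  refine (if_neg h').trans ?_
  congr 2
  funext i; fin_cases i <;> simp [Function.update]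

theorem emit (b : Bool) : Realizable (fun s (_ : Unit) s' => s' = s.emit b) := by
  refine single (.writeOut b ()) trivial ?_
  rintro M q φ hq s e s' rfl
  simp [OracleMachine.next, CounterState.toConfig, hq, Instr.map, CounterState.emit]

/-! ### Arithmetic on the two counters -/

theorem addA (k : ℕ) : Realizable (fun s (_ : Unit) s' => s' = { s with a := s.a + k }) := by
  induction k with
  | zero => exact (skip ()).mono fun s _ s' h => ⟨rfl, h⟩
  | succ k ih =>
    refine (ih.bind fun _ => incA).mono ?_
    rintro s _ s' rfl
    exact ⟨(), _, rfl, rfl⟩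

/-- Add `k` times the second counter to the first one. -/
theorem moveBA (k : ℕ) :
    Realizable (fun s (_ : Unit) s' => s' = { s with a := s.a + k * s.b, b := 0 }) := by
  have body : Realizable (fun s (e : Option Unit) s' =>
      (s.b = 0 ∧ e = some () ∧ s' = s) ∨
      (s.b ≠ 0 ∧ e = none ∧ s' = { s with a := s.a + k, b := s.b - 1 })) := by
    refine (testB.bind (R' := fun z s e s' => (z = true ∧ e = some () ∧ s' = s) ∨
      (z = false ∧ s.b ≠ 0 ∧ e = none ∧ s' = { s with a := s.a + k, b := s.b - 1 })) ?_).mono ?_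
    · rintro (_ | _)
      · refine ((decB.bind fun _ => addA k).bind fun _ => skip none).mono ?_
        rintro s e s' (⟨h, _⟩ | ⟨_, h, rfl, rfl⟩)
        · cases h
        · exact ⟨(), _, ⟨(), _, ⟨h, rfl⟩, rfl⟩, rfl, rfl⟩
      · refine (skip (some ())).mono ?_
        rintro s e s' (⟨_, h⟩ | ⟨h, _⟩)
        · exact h
        · cases h
    · rintro s e s' (⟨h, rfl, rfl⟩ | ⟨h, rfl, rfl⟩)
      · exact ⟨true, _, ⟨by simp [h], rfl⟩, .inl ⟨rfl, rfl, rfl⟩⟩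
      · exact ⟨false, _, ⟨by simp [h], rfl⟩, .inr ⟨rfl, h, rfl, rfl⟩⟩
  refine body.loop.mono ?_
  rintro s _ s' rfl
  obtain ⟨x, p, a, b, o, oh⟩ := s
  induction b generalizing a with
  | zero => exact .finish (.inl ⟨rfl, rfl, rfl⟩)
  | succ b ih =>
    refine .again (.inr ⟨Nat.succ_ne_zero b, rfl, rfl⟩) ?_
    have := ih (a + k)
    simpa [Nat.mul_add, Nat.add_assoc, Nat.add_comm, Nat.add_left_comm] using this

/-- Add the first counter to the second one. -/
theorem moveAB : Realizable (fun s (_ : Unit) s' => s' = { s with a := 0, b := s.b + s.a }) := by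
  have body : Realizable (fun s (e : Option Unit) s' =>
      (s.a = 0 ∧ e = some () ∧ s' = s) ∨
      (s.a ≠ 0 ∧ e = none ∧ s' = { s with a := s.a - 1, b := s.b + 1 })) := by
    refine (testA.bind (R' := fun z s e s' => (z = true ∧ e = some () ∧ s' = s) ∨
      (z = false ∧ s.a ≠ 0 ∧ e = none ∧ s' = { s with a := s.a - 1, b := s.b + 1 })) ?_).mono ?_
    · rintro (_ | _)
      · refine ((decA.bind fun _ => incB).bind fun _ => skip none).mono ?_
        rintro s e s' (⟨h, _⟩ | ⟨_, h, rfl, rfl⟩)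
        · cases h
        · exact ⟨(), _, ⟨(), _, ⟨h, rfl⟩, rfl⟩, rfl, rfl⟩
      · refine (skip (some ())).mono ?_
        rintro s e s' (⟨_, h⟩ | ⟨h, _⟩)
        · exact h
        · cases h
    · rintro s e s' (⟨h, rfl, rfl⟩ | ⟨h, rfl, rfl⟩)
      · exact ⟨true, _, ⟨by simp [h], rfl⟩, .inl ⟨rfl, rfl, rfl⟩⟩
      · exact ⟨false, _, ⟨by simp [h], rfl⟩, .inr ⟨rfl, h, rfl, rfl⟩⟩
  refine body.loop.mono ?_
  rintro s _ s' rfl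
  obtain ⟨x, p, a, b, o, oh⟩ := s
  induction a generalizing b with
  | zero => exact .finish (.inl ⟨rfl, rfl, rfl⟩)
  | succ a ih =>
    refine .again (.inr ⟨Nat.succ_ne_zero a, rfl, rfl⟩) ?_
    have := ih (b + 1)
    simpa [Nat.add_assoc, Nat.add_comm, Nat.add_left_comm] using this

/-- The contents are moved to the empty second counter, then returned with `k` units for each unit.
-/
theorem mulA (k : ℕ) :
    Realizable (fun s (_ : Unit) s' => s.b = 0 ∧ s' = { s with a := k * s.a }) := by
  refine (moveAB.bind fun _ => moveBA k).mono ?_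
  rintro s _ s' ⟨h, rfl⟩
  exact ⟨(), _, rfl, by simp [h]⟩

/-- Subtract `k` from the first counter if possible. -/
theorem trySubA (k : ℕ) :
    Realizable (fun s e s' => (k ≤ s.a ∧ e = true ∧ s' = { s with a := s.a - k }) ∨
      (s.a < k ∧ e = false ∧ s' = s)) := by
  induction k with
  | zero =>
    refine (skip true).mono ?_
    rintro s e s' (⟨_, rfl, rfl⟩ | ⟨h, _⟩)
    · exact ⟨rfl, rfl⟩
    · exact absurd h (Nat.not_lt_zero _)
  | succ k ih =>
    refine (ih.bind (R' := fun z s e s' => (z = false ∧ e = false ∧ s' = s) ∨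
      (z = true ∧ s.a = 0 ∧ e = false ∧ s' = { s with a := k }) ∨
      (z = true ∧ s.a ≠ 0 ∧ e = true ∧ s' = { s with a := s.a - 1 })) ?_).mono ?_
    · rintro (_ | _)
      · refine (skip false).mono ?_
        rintro s e s' (⟨_, h⟩ | ⟨h, _⟩ | ⟨h, _⟩)
        · exact h
        · cases h
        · cases h
      · refine (testA.bind (R' := fun z s e s' =>
          (z = true ∧ s.a = 0 ∧ e = false ∧ s' = { s with a := k }) ∨
          (z = false ∧ s.a ≠ 0 ∧ e = true ∧ s' = { s with a := s.a - 1 })) ?_).mono ?_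
        · rintro (_ | _)
          · refine (decA.bind fun _ => skip true).mono ?_
            rintro s e s' (⟨h, _⟩ | ⟨_, h, rfl, rfl⟩)
            · cases h
            · exact ⟨(), _, ⟨h, rfl⟩, rfl, rfl⟩
          -- Here `k` units were removed but the last one is missing, so the `k` units are restored
          -- before reporting failure.
          · refine ((addA k).bind fun _ => skip false).mono ?_
            rintro s e s' (⟨_, h, rfl, rfl⟩ | ⟨h, _⟩)
            · exact ⟨(), _, rfl, rfl, by simp [h]⟩
            · cases h
        · rintro s e s' (⟨h, _⟩ | ⟨_, h, rfl, rfl⟩ | ⟨_, h, rfl, rfl⟩)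
          · cases h
          · exact ⟨true, _, ⟨by simp [h], rfl⟩, .inl ⟨rfl, h, rfl, rfl⟩⟩
          · exact ⟨false, _, ⟨by simp [h], rfl⟩, .inr ⟨rfl, h, rfl, rfl⟩⟩
    · rintro s e s' (⟨h, rfl, rfl⟩ | ⟨h, rfl, rfl⟩)
      · refine ⟨true, _, .inl ⟨by omega, rfl, rfl⟩, .inr (.inr ⟨rfl, ?_, rfl, ?_⟩)⟩
        · show s.a - k ≠ 0
          omega
        · simp [Nat.sub_sub]
      · rcases Nat.lt_or_ge s'.a k with h' | h'
        · exact ⟨false, _, .inr ⟨h', rfl, rfl⟩, .inl ⟨rfl, rfl, rfl⟩⟩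
        · obtain ⟨x, p, a, b, o, oh⟩ := s'
          obtain rfl : a = k := by simp only at h h'; omega
          exact ⟨true, _, .inl ⟨le_rfl, rfl, rfl⟩, .inr (.inl ⟨rfl, Nat.sub_self a, rfl, rfl⟩)⟩

/-- Divide the first counter by `k` if possible. -/
theorem divA (k : ℕ) (hk : 0 < k) :
    Realizable (fun s e s' => s.b = 0 ∧ ((k ∣ s.a ∧ e = true ∧ s' = { s with a := s.a / k }) ∨
      (¬ k ∣ s.a ∧ e = false ∧ s' = s))) := by
  have body : Realizable (fun s (e : Option Unit) s' =>
      (s.a < k ∧ e = some () ∧ s' = s) ∨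
      (k ≤ s.a ∧ e = none ∧ s' = { s with a := s.a - k, b := s.b + 1 })) := by
    refine ((trySubA k).bind (R' := fun z s e s' => (z = false ∧ e = some () ∧ s' = s) ∨
      (z = true ∧ e = none ∧ s' = { s with b := s.b + 1 })) ?_).mono ?_
    · rintro (_ | _)
      · refine (skip (some ())).mono ?_
        rintro s e s' (⟨_, h⟩ | ⟨h, _⟩)
        · exact h
        · cases h
      · refine (incB.bind fun _ => skip none).mono ?_
        rintro s e s' (⟨h, _⟩ | ⟨_, rfl, rfl⟩)
        · cases h
        · exact ⟨(), _, rfl, rfl, rfl⟩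
    · rintro s e s' (⟨h, rfl, rfl⟩ | ⟨h, rfl, rfl⟩)
      · exact ⟨false, _, .inr ⟨h, rfl, rfl⟩, .inl ⟨rfl, rfl, rfl⟩⟩
      · exact ⟨true, _, .inl ⟨h, rfl, rfl⟩, .inr ⟨rfl, rfl, rfl⟩⟩
  have divide : Realizable (fun s (_ : Unit) s' =>
      s' = { s with a := s.a % k, b := s.b + s.a / k }) := by
    refine body.loop.mono ?_
    rintro s _ s' rfl
    obtain ⟨x, p, a, b, o, oh⟩ := s
    induction a using Nat.strong_induction_on generalizing b with
    | _ a ih =>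
      rcases Nat.lt_or_ge a k with h | h
      · exact .finish (.inl ⟨h, rfl, by simp [Nat.mod_eq_of_lt h, Nat.div_eq_of_lt h]⟩)
      · refine .again (.inr ⟨h, rfl, rfl⟩) ?_
        have := ih (a - k) (by omega) (b + 1)
        have h1 : a % k = (a - k) % k := Nat.mod_eq_sub_mod h
        have h2 : a / k = (a - k) / k + 1 := Nat.div_eq_sub_div hk h
        simp only at this ⊢
        rw [h1, h2, show b + ((a - k) / k + 1) = b + 1 + (a - k) / k by omega]
        exact this
  -- After `divide` the first counter holds the remainder and the second the quotient. On remainder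
  -- `0` the quotient is moved back; otherwise the original number is rebuilt as remainder plus `k`
  -- times quotient.
  refine (divide.bind fun _ => testA.bind (R' := fun z s e s' =>
    (z = true ∧ e = true ∧ s' = { s with a := s.a + 1 * s.b, b := 0 }) ∨
    (z = false ∧ e = false ∧ s' = { s with a := s.a + k * s.b, b := 0 })) ?_).mono ?_
  · rintro (_ | _)
    · refine ((moveBA k).bind fun _ => skip false).mono ?_
      rintro s e s' (⟨h, _⟩ | ⟨_, rfl, rfl⟩)
      · cases h
      · exact ⟨(), _, rfl, rfl, rfl⟩
    · refine ((moveBA 1).bind fun _ => skip true).mono ?_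
      rintro s e s' (⟨_, rfl, rfl⟩ | ⟨h, _⟩)
      · exact ⟨(), _, rfl, rfl, rfl⟩
      · cases h
  · rintro s e s' ⟨hb, (⟨h, rfl, rfl⟩ | ⟨h, rfl, rfl⟩)⟩
    · have h' : s.a % k = 0 := Nat.mod_eq_zero_of_dvd h
      exact ⟨(), _, rfl, true, _, ⟨by simp [h'], rfl⟩, .inl ⟨rfl, rfl, by simp [h', hb]⟩⟩
    · have h' : s'.a % k ≠ 0 := fun h' => h (Nat.dvd_of_mod_eq_zero h')
      refine ⟨(), _, rfl, false, _, ⟨by simp [h'], rfl⟩, .inr ⟨rfl, rfl, ?_⟩⟩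
      obtain ⟨x, p, a, b, o, oh⟩ := s'
      simp only at hb
      subst hb
      simp [Nat.mod_add_div]

end Realizable

/-! ### Register programs -/

/-- Encoding of finitely many registers by a product of prime powers. -/
noncomputable def registerCode (σ : ℕ →₀ ℕ) : ℕ := σ.prod fun i k => Nat.nth Nat.Prime i ^ k

theorem registerCode_zero : registerCode 0 = 1 := by simp [registerCode]

theorem registerCode_add_single (σ : ℕ →₀ ℕ) (i : ℕ) :
    registerCode (σ + Finsupp.single i 1) = Nat.nth Nat.Prime i * registerCode σ := by
  unfold registerCode
  rw [Finsupp.prod_add_index' (by simp) (by intros; rw [pow_add]), mul_comm]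
  simp

theorem prime_nth (i : ℕ) : (Nat.nth Nat.Prime i).Prime := Nat.prime_nth_prime i

theorem sub_add_single {σ : ℕ →₀ ℕ} {i : ℕ} (h : σ i ≠ 0) :
    σ - Finsupp.single i 1 + Finsupp.single i 1 = σ := by
  ext r
  by_cases hr : i = r
  · subst hr; simp; omega
  · simp [hr]

/-- This makes divisibility by a prime the zero test for a register, so that `divA` performs test
and decrement at once. -/
theorem dvd_registerCode {σ : ℕ →₀ ℕ} {i : ℕ} :
    Nat.nth Nat.Prime i ∣ registerCode σ ↔ σ i ≠ 0 := by
  constructor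
  · intro h h0
    unfold registerCode Finsupp.prod at h
    obtain ⟨j, hj, hd⟩ := ((prime_nth i).prime.dvd_finsetProd_iff _).1 h
    have := (Nat.prime_dvd_prime_iff_eq (prime_nth i) (prime_nth j)).1
      ((prime_nth i).dvd_of_dvd_pow hd)
    have := Nat.nth_injective Nat.infinite_setOfPred_prime this
    subst this
    exact (Finsupp.mem_support_iff.1 hj) h0
  · intro h
    rw [← sub_add_single h, registerCode_add_single]
    exact dvd_mul_right _ _

theorem registerCode_div {σ : ℕ →₀ ℕ} {i : ℕ} (h : σ i ≠ 0) :
    registerCode σ / Nat.nth Nat.Prime i = registerCode (σ - Finsupp.single i 1) := by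
  conv_lhs => rw [← sub_add_single h, registerCode_add_single]
  exact Nat.mul_div_cancel_left _ (prime_nth i).pos

/-- The transformation `T` of the registers is realized by a flowchart. -/
def RegRealizable (T : (ℕ →₀ ℕ) → (ℕ →₀ ℕ)) : Prop :=
  Realizable (fun s (_ : Unit) s' =>
    ∃ σ, s.a = registerCode σ ∧ s.b = 0 ∧ s' = { s with a := registerCode (T σ) })

theorem Realizable.testDec (i : ℕ) :
    Realizable (fun s e s' => ∃ σ, s.a = registerCode σ ∧ s.b = 0 ∧
      ((σ i ≠ 0 ∧ e = true ∧ s' = { s with a := registerCode (σ - Finsupp.single i 1) }) ∨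
        (σ i = 0 ∧ e = false ∧ s' = s))) := by
  refine (Realizable.divA _ (prime_nth i).pos).mono ?_
  rintro s e s' ⟨σ, ha, hb, (⟨h, rfl, rfl⟩ | ⟨h, rfl, rfl⟩)⟩
  · exact ⟨hb, .inl ⟨by rw [ha]; exact dvd_registerCode.2 h, rfl, by
      rw [ha, registerCode_div h]⟩⟩
  · exact ⟨hb, .inr ⟨by rw [ha, dvd_registerCode]; simp [h], rfl, rfl⟩⟩

namespace RegRealizable

theorem inc (i : ℕ) : RegRealizable (fun σ => σ + Finsupp.single i 1) := by
  refine (Realizable.mulA (Nat.nth Nat.Prime i)).mono ?_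
  rintro s _ s' ⟨σ, ha, hb, rfl⟩
  exact ⟨hb, by rw [ha, registerCode_add_single]⟩

theorem id : RegRealizable (fun σ => σ) := by
  refine (Realizable.skip ()).mono ?_
  rintro s _ s' ⟨σ, ha, hb, rfl⟩
  exact ⟨rfl, by rw [← ha]⟩

theorem comp {T T' : (ℕ →₀ ℕ) → (ℕ →₀ ℕ)} (h' : RegRealizable T') (h : RegRealizable T) :
    RegRealizable (fun σ => T' (T σ)) := by
  refine (h.bind fun _ => h').mono ?_
  rintro s _ s' ⟨σ, ha, hb, rfl⟩
  exact ⟨(), _, ⟨σ, ha, hb, rfl⟩, T σ, rfl, hb, rfl⟩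

/-- Each round decrements register `i` and then applies `T`. Since `T` preserves register `i`, the
number of rounds is its initial content. -/
theorem loop {T : (ℕ →₀ ℕ) → (ℕ →₀ ℕ)} (h : RegRealizable T) (i : ℕ)
    (hi : ∀ σ, T σ i = σ i) :
    RegRealizable (fun σ => (fun τ => T (τ - Finsupp.single i 1))^[σ i] σ) := by
  let R : CounterState → Option Unit → CounterState → Prop := fun s e s' =>
    ∃ σ, s.a = registerCode σ ∧ s.b = 0 ∧
      ((σ i ≠ 0 ∧ e = none ∧ s' = { s with a := registerCode (T (σ - Finsupp.single i 1)) }) ∨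
      (σ i = 0 ∧ e = some () ∧ s' = s))
  have body : Realizable R := by
    refine ((Realizable.testDec i).bind (R' := fun z s e s' =>
      (z = true ∧ e = none ∧
        ∃ σ, s.a = registerCode σ ∧ s.b = 0 ∧ s' = { s with a := registerCode (T σ) }) ∨
      (z = false ∧ e = some () ∧ s' = s)) ?_).mono ?_
    · rintro (_ | _)
      · refine (Realizable.skip (some ())).mono ?_
        rintro s e s' (⟨h, _⟩ | ⟨_, h⟩)
        · cases h
        · exact h
      · refine (Realizable.bind h fun _ => Realizable.skip none).mono ?_
        rintro s e s' (⟨_, rfl, h⟩ | ⟨h, _⟩)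
        · exact ⟨(), _, h, rfl, rfl⟩
        · cases h
    · rintro s e s' ⟨σ, ha, hb, (⟨h, rfl, rfl⟩ | ⟨h, rfl, rfl⟩)⟩
      · exact ⟨true, _, ⟨σ, ha, hb, .inl ⟨h, rfl, rfl⟩⟩, .inl ⟨rfl, rfl, _, rfl, hb, rfl⟩⟩
      · exact ⟨false, _, ⟨σ, ha, hb, .inr ⟨h, rfl, rfl⟩⟩, .inr ⟨rfl, rfl, rfl⟩⟩
  refine body.loop.mono ?_
  rintro s _ s' ⟨σ, ha, hb, rfl⟩
  obtain ⟨x, p, a, b, o, oh⟩ := s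
  simp only at ha hb
  subst ha hb
  have key : ∀ k σ, σ i = k → Realizable.Loop R ⟨x, p, registerCode σ, 0, o, oh⟩ ()
      ⟨x, p, registerCode ((fun τ => T (τ - Finsupp.single i 1))^[k] σ), 0, o, oh⟩ := by
    intro k
    induction k with
    | zero => intro σ hk; exact .finish ⟨σ, rfl, rfl, .inr ⟨hk, rfl, rfl⟩⟩
    | succ k ih =>
      intro σ hk
      refine .again ⟨σ, rfl, rfl, .inl ⟨by omega, rfl, rfl⟩⟩ ?_
      exact ih (T (σ - Finsupp.single i 1)) (by rw [hi]; simp [hk])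
  exact key _ σ rfl

end RegRealizable

theorem iterate_invariant {α : Type*} (f : α → α) (P : ℕ → α → Prop) {a : α} (h0 : P 0 a)
    (hs : ∀ k a, P k a → P (k + 1) (f a)) (k : ℕ) : P k (f^[k] a) := by
  induction k with
  | zero => exact h0
  | succ k ih => rw [Function.iterate_succ_apply']; exact hs _ _ ih

/-- A realizable transformation of the registers stores `F` in the register `out` and leaves the
other registers below `base` unchanged. -/
def Computes (base out : ℕ) (F : (ℕ →₀ ℕ) → ℕ) : Prop :=
  ∃ T, RegRealizable T ∧ ∀ σ, T σ out = F σ ∧ ∀ r < base, r ≠ out → T σ r = σ r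

theorem computes_zero (base out : ℕ) : Computes base out (fun _ => 0) := by
  -- A loop with empty body drains the register that controls it.
  refine ⟨_, RegRealizable.id.loop out fun _ => rfl, fun σ => ?_⟩
  have := iterate_invariant (fun τ : ℕ →₀ ℕ => τ - Finsupp.single out 1)
    (fun k τ => ∀ r, τ r = if r = out then σ out - k else σ r) (a := σ)
    (by intro r; split_ifs with h <;> simp [h])
    (by
      intro k τ h r
      by_cases hr : r = out
      · subst hr; have := h r; simp at this ⊢; omega
      · have := h r
        simp only [hr, if_false] at this ⊢
        rw [Finsupp.tsub_apply, Finsupp.single_eq_of_ne hr, this, Nat.sub_zero]) (σ out)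
  refine ⟨by simpa using this out, fun r _ hr => by simpa [hr] using this r⟩

/-- The contents of register `i` are added to two other registers. -/
theorem exists_regRealizable_distribute {i o t : ℕ} (ho : o ≠ i) (ht : t ≠ i) (hot : o ≠ t) :
    ∃ T, RegRealizable T ∧ ∀ σ r, T σ r =
      if r = i then 0 else if r = o ∨ r = t then σ r + σ i else σ r := by
  refine ⟨_, ((RegRealizable.inc o).comp (RegRealizable.inc t)).loop i ?_, fun σ r => ?_⟩
  · intro σ; simp [Finsupp.single_eq_of_ne ho.symm, Finsupp.single_eq_of_ne ht.symm]
  have := iterate_invariant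
    (fun τ : ℕ →₀ ℕ => τ - Finsupp.single i 1 + Finsupp.single t 1 + Finsupp.single o 1)
    (fun k τ => ∀ r, τ r = if r = i then σ i - k else if r = o ∨ r = t then σ r + k else σ r)
    (a := σ) (by intro r; split_ifs with h <;> simp [h])
    (by
      intro k τ h r
      have := h r
      simp only [Finsupp.add_apply, Finsupp.tsub_apply, Finsupp.single_apply, this]
      grind) (σ i) r
  simpa using this

/-- The contents of register `i` are added to another register. -/
theorem exists_regRealizable_move {i o : ℕ} (ho : o ≠ i) :
    ∃ T, RegRealizable T ∧ ∀ σ r, T σ r =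
      if r = i then 0 else if r = o then σ r + σ i else σ r := by
  refine ⟨_, (RegRealizable.inc o).loop i ?_, fun σ r => ?_⟩
  · intro σ; simp [Finsupp.single_eq_of_ne ho.symm]
  have := iterate_invariant
    (fun τ : ℕ →₀ ℕ => τ - Finsupp.single i 1 + Finsupp.single o 1)
    (fun k τ => ∀ r, τ r = if r = i then σ i - k else if r = o then σ r + k else σ r)
    (a := σ) (by intro r; split_ifs with h <;> simp [h])
    (by
      intro k τ h r
      have := h r
      simp only [Finsupp.add_apply, Finsupp.tsub_apply, Finsupp.single_apply, this]
      grind) (σ i) r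
  simpa using this

/-- Reading a register destroys it, so its contents are distributed to `out` and to the scratch
register `base`, and then moved back from `base`. -/
theorem computes_copy {base out i : ℕ} (ho : out < base) (hi : i < base) (hio : i ≠ out) :
    Computes base out (fun σ => σ i) := by
  obtain ⟨C, hC, hC'⟩ := computes_zero (base + 1) out
  obtain ⟨D, hD, hD'⟩ := computes_zero (base + 1) base
  obtain ⟨S, hS, hS'⟩ := exists_regRealizable_distribute (i := i) (o := out) (t := base)
    hio.symm hi.ne' ho.ne
  obtain ⟨U, hU, hU'⟩ := exists_regRealizable_move (i := base) (o := i) hi.ne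
  refine ⟨_, hU.comp (hS.comp (hD.comp hC)), fun σ => ?_⟩
  have key : ∀ r < base, r ≠ out → D (C σ) r = σ r := fun r hr hro => by
    rw [(hD' _).2 r (by omega) (by omega), (hC' _).2 r (by omega) hro]
  have k1 : D (C σ) out = 0 := by rw [(hD' _).2 out (by omega) (by omega), (hC' _).1]
  have k2 : D (C σ) base = 0 := (hD' _).1
  have k3 := key i hi hio
  constructor
  · simp only [hU', hS']
    grind
  · intro r hr hro
    have := key r hr hro
    simp only [hU', hS']
    grind

theorem Computes.comp {base base' out : ℕ} {F G : (ℕ →₀ ℕ) → ℕ} {T : (ℕ →₀ ℕ) → (ℕ →₀ ℕ)}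
    (h : Computes base' out F) (hT : RegRealizable T) (hb : base ≤ base')
    (hTr : ∀ σ, ∀ r < base, T σ r = σ r) (hFG : ∀ σ, F (T σ) = G σ) : Computes base out G := by
  obtain ⟨S, hS, hS'⟩ := h
  refine ⟨_, hS.comp hT, fun σ => ⟨by rw [(hS' _).1, hFG], fun r hr hro => ?_⟩⟩
  rw [(hS' _).2 r (by omega) hro, hTr σ r hr]

open List.Vector in
-- Induction on the construction of `f`. Registers from `base` on are scratch space; generalizing
-- over `base` lets a subprogram protect the intermediate results of its caller.
theorem computes_of_primrec' {n : ℕ} {f : List.Vector ℕ n → ℕ} (hf : Nat.Primrec' f) :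
    ∀ (base out : ℕ) (ins : Fin n → ℕ), out < base → (∀ j, ins j < base ∧ ins j ≠ out) →
      Computes base out (fun σ => f (ofFn fun j => σ (ins j))) := by
  induction hf with
  | zero => intro base out _ _ _; exact computes_zero base out
  | succ =>
    intro base out ins ho hi
    obtain ⟨T, hT, hT'⟩ := computes_copy ho (hi 0).1 (hi 0).2
    refine ⟨_, (RegRealizable.inc out).comp hT, fun σ => ⟨?_, fun r hr hro => ?_⟩⟩
    · simp [(hT' σ).1, ofFn]
    · simp [(hT' σ).2 r hr hro, Finsupp.single_eq_of_ne hro]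
  | get i =>
    intro base out ins ho hi
    simpa using computes_copy ho (hi i).1 (hi i).2
  | @comp m n f g _ _ ihf ihg =>
    intro base out ins ho hi
    -- The value of `g i` is stored in register `base + i`; later subprograms use scratch space only
    -- from `base + n` on.
    have aux : ∀ j ≤ n, ∃ T, RegRealizable T ∧ ∀ σ,
        (∀ i : Fin n, (i : ℕ) < j → T σ (base + i) = g i (ofFn fun j => σ (ins j))) ∧
        ∀ r < base, T σ r = σ r := by
      intro j
      induction j with
      | zero => intro _; exact ⟨_, RegRealizable.id, fun σ => ⟨by simp, fun _ _ => rfl⟩⟩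
      | succ j ih =>
        intro hj
        obtain ⟨T, hT, hT'⟩ := ih (by omega)
        obtain ⟨S, hS, hS'⟩ := ihg ⟨j, hj⟩ (base + n) (base + j) ins (by omega)
          (fun i => ⟨by have := (hi i).1; omega, by have := (hi i).1; omega⟩)
        refine ⟨_, hS.comp hT, fun σ => ⟨fun i hij => ?_, fun r hr => ?_⟩⟩
        · rcases Nat.lt_succ_iff_lt_or_eq.1 hij with h | h
          · rw [(hS' _).2 _ (by omega) (by omega), (hT' σ).1 i h]
          · obtain rfl : i = ⟨j, hj⟩ := Fin.ext h
            rw [(hS' _).1]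
            exact congrArg (g _) (congrArg ofFn (funext fun l => (hT' σ).2 _ (hi l).1))
        · rw [(hS' _).2 _ (by omega) (by omega), (hT' σ).2 r hr]
    obtain ⟨T, hT, hT'⟩ := aux n le_rfl
    refine (ihf (base + n) out (fun j => base + j) (by omega)
      (fun j => ⟨by omega, by omega⟩)).comp hT (by omega) (fun σ => (hT' σ).2) fun σ => ?_
    congr 2
    funext j
    exact (hT' σ).1 j j.2
  | @prec n f g _ _ ihf ihg =>
    intro base out ins ho hi
    -- Layout for primitive recursion: `base` is the recursion index, `base + 1` the current value,
    -- `base + 2` the number of remaining rounds, and `base + 3` receives the next value.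
    obtain ⟨A, hA, hA'⟩ := computes_copy (base := base + 4) (out := base + 2) (i := ins 0)
      (by omega) (by have := (hi 0).1; omega) (by have := (hi 0).1; omega)
    obtain ⟨B, hB, hB'⟩ := computes_zero (base + 4) base
    obtain ⟨C, hC, hC'⟩ := ihf (base + 4) (base + 1) (fun j => ins j.succ) (by omega)
      (fun j => ⟨by have := (hi j.succ).1; omega, by have := (hi j.succ).1; omega⟩)
    obtain ⟨D, hD, hD'⟩ := ihg (base + 4) (base + 3)
      (Fin.cons base (Fin.cons (base + 1) fun j => ins j.succ)) (by omega) (by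
        intro j
        refine Fin.cases ?_ (fun j => Fin.cases ?_ (fun j => ?_) j) j
        · simp
        · simp
        · have := (hi j.succ).1
          simp only [Fin.cons_succ]
          omega)
    obtain ⟨E, hE, hE'⟩ := computes_copy (base := base + 4) (out := base + 1) (i := base + 3)
      (by omega) (by omega) (by omega)
    have hF := (RegRealizable.inc base).comp (hE.comp hD)
    have hG := hF.loop (base + 2) (fun σ => by
      have : (Finsupp.single base 1 : ℕ →₀ ℕ) (base + 2) = 0 :=
        Finsupp.single_eq_of_ne (by omega)
      rw [Finsupp.add_apply, this, (hE' _).2 _ (by omega) (by omega),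
        (hD' _).2 _ (by omega) (by omega), add_zero])
    have hH := hG.comp (hC.comp (hB.comp hA))
    have key : ∀ σ r, r < base → C (B (A σ)) r = σ r := fun σ r hr => by
      rw [(hC' _).2 _ (by omega) (by omega), (hB' _).2 _ (by omega) (by omega),
        (hA' _).2 _ (by omega) (by omega)]
    have hcnt : ∀ σ, C (B (A σ)) (base + 2) = σ (ins 0) := fun σ => by
      rw [(hC' _).2 _ (by omega) (by omega), (hB' _).2 _ (by omega) (by omega), (hA' _).1]
    have inv := fun σ : ℕ →₀ ℕ => iterate_invariant
      (fun τ => E (D (τ - Finsupp.single (base + 2) 1)) + Finsupp.single base 1)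
      (fun k τ => τ base = k ∧
        τ (base + 1) = Nat.rec (f (ofFn fun j => σ (ins j.succ)))
          (fun y IH => g (y ::ᵥ IH ::ᵥ ofFn fun j => σ (ins j.succ))) k ∧
        ∀ r < base, τ r = σ r) (a := C (B (A σ)))
      (by
        refine ⟨?_, ?_, key σ⟩
        · rw [(hC' _).2 _ (by omega) (by omega), (hB' _).1]
        · rw [(hC' _).1]
          refine congrArg f (congrArg ofFn (funext fun j => ?_))
          have := (hi j.succ).1
          rw [(hB' _).2 _ (by omega) (by omega), (hA' _).2 _ (by omega) (by omega)])
      (by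
        rintro k τ ⟨h1, h2, h3⟩
        have hs : ∀ r, r ≠ base + 2 → (τ - Finsupp.single (base + 2) 1 : ℕ →₀ ℕ) r = τ r := by
          intro r hr
          rw [Finsupp.tsub_apply, Finsupp.single_eq_of_ne hr, Nat.sub_zero]
        refine ⟨?_, ?_, fun r hr => ?_⟩
        · rw [Finsupp.add_apply, Finsupp.single_eq_same, (hE' _).2 _ (by omega) (by omega),
            (hD' _).2 _ (by omega) (by omega), hs _ (by omega), h1]
        · rw [Finsupp.add_apply, Finsupp.single_eq_of_ne (by omega), (hE' _).1]
          change D _ (base + 3) + 0 = g _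
          rw [(hD' _).1, add_zero]
          rw [← h2]
          simp only [ofFn, Fin.cons_zero, Fin.cons_succ]
          rw [hs _ (by omega), hs _ (by omega), h1]
          congr 3
          refine congrArg ofFn (funext fun j => ?_)
          have := (hi j.succ).1
          rw [hs _ (by omega), h3 _ this]
        · rw [Finsupp.add_apply, Finsupp.single_eq_of_ne (by omega),
            (hE' _).2 _ (by omega) (by omega), (hD' _).2 _ (by omega) (by omega),
            hs _ (by omega), h3 r hr, add_zero])
    refine (computes_copy (base := base + 4) (out := out) (i := base + 1) (by omega) (by omega)
      (by omega)).comp hH (by omega) (fun σ r hr => ((inv σ _).2.2 r hr)) fun σ => ?_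
    rw [(inv σ _).2.1, hcnt]
    simp [ofFn]

/-! ### Sequential transition relations -/

namespace OracleMachine

variable {M : OracleMachine}

/-- A deterministic transition relation that writes its output in one pass and halts at accepting
vertices. -/
structure Sequential (T : Config M.V → Config M.V → Prop) : Prop where
  det : ∀ {a b c}, T a b → T a c → b = c
  output : ∀ {c c'}, T c c' → (c'.outHead = c.outHead ∧ c'.out = c.out) ∨
    ∃ b, c'.outHead = c.outHead + 1 ∧ c'.out = Function.update c.out c.outHead b
  accept : ∀ {c c'}, M.node c.q = .accept → ¬ T c c'

theorem sequential_plainStep : Sequential M.PlainStep where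
  det h h' := by
    unfold PlainStep at h h'
    exact Option.some.inj (h.symm.trans h')
  output {c c'} h := by
    unfold PlainStep next at h
    split at h
    all_goals first
      | (cases h; exact .inl ⟨rfl, rfl⟩)
      | (cases h; exact .inr ⟨_, rfl, rfl⟩)
      | (split_ifs at h; cases h; exact .inl ⟨rfl, rfl⟩)
      | cases h
  accept {c c'} hc h := by
    unfold PlainStep next at h
    rw [hc] at h
    cases h

open Classical in
/-- The successor configuration under `T`; halting configurations are repeated. -/
noncomputable def advance (T : Config M.V → Config M.V → Prop) (c : Config M.V) : Config M.V :=
  if h : ∃ c', T c c' then h.choose else c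

namespace Sequential

variable {T : Config M.V → Config M.V → Prop}

theorem advance_eq (hT : Sequential T) {c c' : Config M.V} (h : T c c') : advance T c = c' := by
  have h' : ∃ c', T c c' := ⟨c', h⟩
  rw [advance, dif_pos h']
  exact hT.det h'.choose_spec h

theorem _root_.OracleMachine.advance_of_not {c : Config M.V} (h : ∀ c', ¬ T c c') :
    advance T c = c := by
  rw [advance, dif_neg (by simpa using h)]

theorem _root_.OracleMachine.advance_spec (c : Config M.V) :
    T c (advance T c) ∨ ((∀ c', ¬ T c c') ∧ advance T c = c) := by
  by_cases h : ∃ c', T c c'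
  · left; rw [advance, dif_pos h]; exact h.choose_spec
  · exact .inr ⟨by simpa using h, advance_of_not (by simpa using h)⟩

theorem _root_.OracleMachine.reflTransGen_iterate (c : Config M.V) (t : ℕ) :
    Relation.ReflTransGen T c ((advance T)^[t] c) := by
  induction t with
  | zero => exact .refl
  | succ t ih =>
    rw [Function.iterate_succ_apply']
    rcases advance_spec (T := T) ((advance T)^[t] c) with h | ⟨_, h⟩
    · exact ih.tail h
    · rwa [h]

theorem exists_iterate (hT : Sequential T) {c c' : Config M.V}
    (h : Relation.ReflTransGen T c c') : ∃ t, (advance T)^[t] c = c' := by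
  induction h with
  | refl => exact ⟨0, rfl⟩
  | tail _ h ih =>
    obtain ⟨t, rfl⟩ := ih
    exact ⟨t + 1, by rw [Function.iterate_succ_apply', hT.advance_eq h]⟩

theorem advance_output (hT : Sequential T) (c : Config M.V) :
    ((advance T c).outHead = c.outHead ∧ (advance T c).out = c.out) ∨
    ∃ b, (advance T c).outHead = c.outHead + 1 ∧
      (advance T c).out = Function.update c.out c.outHead b := by
  rcases advance_spec (T := T) c with h | ⟨_, h⟩
  · exact hT.output h
  · rw [h]; exact .inl ⟨rfl, rfl⟩

theorem outHead_mono (hT : Sequential T) (c : Config M.V) :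
    Monotone fun t => ((advance T)^[t] c).outHead := by
  refine monotone_nat_of_le_succ fun t => ?_
  rw [Function.iterate_succ_apply']
  rcases hT.advance_output ((advance T)^[t] c) with h | ⟨_, h, _⟩ <;> omega

theorem out_eq (hT : Sequential T) (c : Config M.V) {t t' k : ℕ} (htt' : t ≤ t')
    (hk : k < ((advance T)^[t] c).outHead) :
    ((advance T)^[t'] c).out k = ((advance T)^[t] c).out k := by
  induction t', htt' using Nat.le_induction with
  | base => rfl
  | succ t' htt' ih =>
    have := hT.outHead_mono c htt'
    simp only at this
    rw [Function.iterate_succ_apply', ← ih]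
    rcases hT.advance_output ((advance T)^[t'] c) with ⟨_, h⟩ | ⟨_, _, h⟩
    · rw [h]
    · rw [h, Function.update_of_ne (by omega)]

theorem out_false (hT : Sequential T) {c : Config M.V}
    (hc : ∀ k, c.outHead ≤ k → c.out k = false) (t : ℕ) :
    ∀ k, ((advance T)^[t] c).outHead ≤ k → ((advance T)^[t] c).out k = false := by
  induction t with
  | zero => exact hc
  | succ t ih =>
    intro k hk
    rw [Function.iterate_succ_apply'] at hk ⊢
    rcases hT.advance_output ((advance T)^[t] c) with ⟨h, h'⟩ | ⟨_, h, h'⟩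
    · rw [h']; exact ih k (by omega)
    · rw [h', Function.update_of_ne (by omega)]; exact ih k (by omega)

/-- A discrete intermediate value argument: the output head advances by at most one cell per step.
-/
theorem exists_outHead_eq (hT : Sequential T) (c : Config M.V) {m t : ℕ} (hm : c.outHead ≤ m)
    (ht : m ≤ ((advance T)^[t] c).outHead) : ∃ t', ((advance T)^[t'] c).outHead = m := by
  induction t with
  | zero => exact ⟨0, le_antisymm hm ht⟩
  | succ t ih =>
    rcases Nat.lt_or_ge ((advance T)^[t] c).outHead m with h | h
    · refine ⟨t + 1, ?_⟩
      rw [Function.iterate_succ_apply'] at ht ⊢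
      rcases hT.advance_output ((advance T)^[t] c) with ⟨h', _⟩ | ⟨_, h', _⟩ <;> omega
    · exact ih h

theorem iterate_eq_of_accept (hT : Sequential T) {c : Config M.V} {t t' : ℕ} (htt' : t ≤ t')
    (h : M.node ((advance T)^[t] c).q = .accept) :
    (advance T)^[t'] c = (advance T)^[t] c := by
  induction t', htt' using Nat.le_induction with
  | base => rfl
  | succ t' _ ih =>
    rw [Function.iterate_succ_apply', ih, advance_of_not fun _ => hT.accept h]

/-- The run is a single orbit of `advance`, and cells behind the output head are final. Hence
convergence of the output tapes amounts to agreement with `w` behind the head. -/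
theorem yields_iff (hT : Sequential T) (c : Config M.V) (w : BinSeq) :
    M.Yields T c w ↔
      (∃ t, M.node ((advance T)^[t] c).q = .accept ∧ ((advance T)^[t] c).out = w) ∨
      ((∀ K, ∃ t, K ≤ ((advance T)^[t] c).outHead) ∧
        ∀ t k, k < ((advance T)^[t] c).outHead → ((advance T)^[t] c).out k = w k) := by
  refine or_congr ⟨?_, ?_⟩ ⟨?_, ?_⟩
  · rintro ⟨c', h, h'⟩
    obtain ⟨t, rfl⟩ := hT.exists_iterate h
    exact ⟨t, h'⟩
  · rintro ⟨t, h⟩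
    exact ⟨_, reflTransGen_iterate c t, h⟩
  · rintro ⟨d, hd, hw⟩
    have hd' : ∀ m, c.outHead ≤ m → ∃ t, (advance T)^[t] c = d m :=
      fun m hm => hT.exists_iterate (hd m hm).1
    constructor
    · intro K
      obtain ⟨t, ht⟩ := hd' (max K c.outHead) (le_max_right _ _)
      exact ⟨t, by rw [ht, (hd _ (le_max_right _ _)).2]; exact le_max_left _ _⟩
    · intro t k hk
      obtain ⟨m, hm, hm'⟩ := ((hw k).and
        (eventually_ge_atTop (max (k + 1) c.outHead))).exists
      obtain ⟨t', ht'⟩ := hd' m ((le_max_right _ _).trans hm')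
      have hk' : k < ((advance T)^[t'] c).outHead := by
        rw [ht', (hd _ ((le_max_right _ _).trans hm')).2]
        exact (le_max_left (k + 1) c.outHead).trans hm'
      rw [← hm, ← ht', ← hT.out_eq c (le_max_left t t') hk,
        ← hT.out_eq c (le_max_right t t') hk']
  · rintro ⟨h, hw⟩
    have : ∀ m, ∃ t, c.outHead ≤ m → ((advance T)^[t] c).outHead = m := by
      intro m
      by_cases hm : c.outHead ≤ m
      · obtain ⟨t, ht⟩ := h m
        obtain ⟨t', ht'⟩ := hT.exists_outHead_eq c hm ht
        exact ⟨t', fun _ => ht'⟩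
      · exact ⟨0, fun h => absurd h hm⟩
    choose t ht using this
    refine ⟨fun m => (advance T)^[t m] c, fun m hm => ⟨reflTransGen_iterate c _, ht m hm⟩,
      fun k => ?_⟩
    filter_upwards [eventually_ge_atTop (max (k + 1) c.outHead)] with m hm
    refine hw _ _ ?_
    rw [ht m ((le_max_right _ _).trans hm)]
    exact (le_max_left (k + 1) c.outHead).trans hm

theorem exists_iterate_succ (hT : Sequential T) {c c' : Config M.V}
    (h : Relation.TransGen T c c') : ∃ t, (advance T)^[t + 1] c = c' := by
  induction h with
  | single h => exact ⟨0, hT.advance_eq h⟩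
  | tail _ h ih =>
    obtain ⟨t, rfl⟩ := ih
    exact ⟨t + 1, by rw [Function.iterate_succ_apply', hT.advance_eq h]⟩

/-- The output of a run that passes through infinitely many given configurations. -/
theorem yields_iff_of_chain (hT : Sequential T) {c : Config M.V} {d : ℕ → Config M.V}
    (h0 : Relation.ReflTransGen T c (d 0)) (hd : ∀ s, Relation.TransGen T (d s) (d (s + 1)))
    (w : BinSeq) :
    M.Yields T c w ↔ (∀ K, ∃ s, K ≤ (d s).outHead) ∧
      ∀ s k, k < (d s).outHead → (d s).out k = w k := by
  have key : ∀ s, ∃ t, s ≤ t ∧ (advance T)^[t] c = d s := by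
    intro s
    induction s with
    | zero =>
      obtain ⟨t, ht⟩ := hT.exists_iterate h0
      exact ⟨t, t.zero_le, ht⟩
    | succ s ih =>
      obtain ⟨t, hst, ht⟩ := ih
      obtain ⟨t', ht'⟩ := hT.exists_iterate_succ (hd s)
      refine ⟨t' + 1 + t, by omega, ?_⟩
      rw [Function.iterate_add_apply, ht, ht']
  choose τ hτ hτ' using key
  rw [hT.yields_iff]
  constructor
  · rintro (⟨t, ht, _⟩ | ⟨h, hw⟩)
    · exfalso
      -- Acceptance would make the orbit stationary, whereas the chain always has a further step.
      have := hT.iterate_eq_of_accept (hτ t) ht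
      rw [hτ'] at this
      rw [← this] at ht
      obtain ⟨c', hc', _⟩ := (Relation.TransGen.head'_iff.1 (hd t))
      exact hT.accept ht hc'
    · refine ⟨fun K => ?_, fun s k hk => ?_⟩
      · obtain ⟨t, ht⟩ := h K
        refine ⟨t, ?_⟩
        rw [← hτ']
        exact ht.trans (hT.outHead_mono c (hτ t))
      · rw [← hτ'] at hk ⊢
        exact hw _ _ hk
  · rintro ⟨h, hw⟩
    refine .inr ⟨fun K => ?_, fun t k hk => ?_⟩
    · obtain ⟨s, hs⟩ := h K
      exact ⟨τ s, by rwa [hτ']⟩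
    · have := hT.outHead_mono c (hτ t)
      rw [← hT.out_eq c (hτ t) hk, hτ']
      refine hw _ _ ?_
      rw [← hτ']
      exact hk.trans_le this

end Sequential

end OracleMachine

/-! ### Machines that work in stages -/

/-- Writing the code of a symbol on the output tape: `0` is no symbol, `1` the revising mark, and
`2` and `3` are the two bits. -/
def CounterState.emitCode (s : CounterState) : ℕ → CounterState
  | 0 => s
  | 1 => (s.emit true).emit true
  | 2 => (s.emit false).emit false
  | _ + 3 => (s.emit false).emit true

theorem Realizable.decRegister (i : ℕ) :
    Realizable (fun s e s' => ∃ σ, s.a = registerCode σ ∧ s.b = 0 ∧ e = decide (σ i ≠ 0) ∧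
      s' = { s with a := registerCode (σ - Finsupp.single i 1) }) := by
  refine (Realizable.testDec i).mono ?_
  rintro s e s' ⟨σ, ha, hb, rfl, rfl⟩
  refine ⟨σ, ha, hb, ?_⟩
  by_cases h : σ i = 0
  · refine .inr ⟨h, by simp [h], ?_⟩
    have : σ - Finsupp.single i 1 = σ := by
      ext r
      by_cases hr : r = i
      · subst hr; simp [h]
      · simp [Finsupp.single_eq_of_ne hr]
    rw [this, ← ha]
  · exact .inl ⟨h, by simp [h], rfl⟩

/-- Three successive decrements, each reporting whether the register was nonzero, distinguish the
codes `0`, `1`, `2` and at least `3`. -/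
theorem Realizable.emitRegister (i : ℕ) :
    Realizable (fun s (_ : Unit) s' => ∃ σ, s.a = registerCode σ ∧ s.b = 0 ∧
      s' = { s with a := registerCode (σ - Finsupp.single i 1 - Finsupp.single i 1 -
        Finsupp.single i 1) }.emitCode (σ i)) := by
  have two : ∀ b b', Realizable (fun s (_ : Unit) s' => s' = (s.emit b).emit b') := fun b b' =>
    ((Realizable.emit b).bind fun _ => Realizable.emit b').mono fun s _ _ h => ⟨(), _, rfl, h⟩
  refine ((Realizable.decRegister i).bind fun e₁ => (Realizable.decRegister i).bind fun e₂ =>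
    (Realizable.decRegister i).bind (R' := fun e₃ s _ s' => s' = s.emitCode
      (if e₁ then if e₂ then if e₃ then 3 else 2 else 1 else 0)) fun e₃ => ?_).mono ?_
  · cases e₁ <;> cases e₂ <;> cases e₃ <;>
      first
      | exact (Realizable.skip ()).mono fun s _ _ h => ⟨rfl, h⟩
      | exact two _ _
  · rintro s _ s' ⟨σ, ha, hb, rfl⟩
    refine ⟨_, _, ⟨σ, ha, hb, rfl, rfl⟩, _, _, ⟨_, rfl, hb, rfl, rfl⟩, _, _,
      ⟨_, rfl, hb, rfl, rfl⟩, ?_⟩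
    simp only [Finsupp.tsub_apply, Finsupp.single_eq_same]
    generalize σ i = n
    match n with
    | 0 => rfl
    | 1 => rfl
    | 2 => rfl
    | _ + 3 => simp [CounterState.emitCode]

theorem Realizable.stage (f : Bool → ℕ → ℕ) (hf : ∀ b, Primrec (f b)) (g : ℕ → ℕ)
    (hg : Primrec g) :
    ∃ T : Bool → (ℕ →₀ ℕ) → (ℕ →₀ ℕ), (∀ b σ, T b σ 0 = f b (σ 0)) ∧
      Realizable (fun s (_ : Unit) s' => ∃ σ, s.a = registerCode σ ∧ s.b = 0 ∧
        s' = { s with pos := s.pos + 1, a := registerCode (T (s.input s.pos) σ) }.emitCode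
          (g (f (s.input s.pos) (σ 0)))) := by
  have H : ∀ b, ∃ T, RegRealizable T ∧ ∀ σ, T σ 0 = f b (σ 0) ∧ T σ 2 = g (f b (σ 0)) := by
    intro b
    -- Register `0` holds the state and register `2` receives the symbol code. The new state is
    -- computed in register `1` and copied back, because a program may not overwrite its argument.
    obtain ⟨A, hA, hA'⟩ := computes_of_primrec' (Nat.Primrec'.prim_iff₁.2 (hf b)) 3 1
      (fun _ => 0) (by omega) (by intro j; omega)
    obtain ⟨B, hB, hB'⟩ := computes_copy (base := 3) (out := 0) (i := 1) (by omega) (by omega)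
      (by omega)
    obtain ⟨C, hC, hC'⟩ := computes_of_primrec' (Nat.Primrec'.prim_iff₁.2 hg) 3 2
      (fun _ => 0) (by omega) (by intro j; omega)
    have h0 : ∀ σ, B (A σ) 0 = f b (σ 0) := fun σ => by rw [(hB' _).1]; exact (hA' _).1
    refine ⟨_, hC.comp (hB.comp hA), fun σ => ⟨?_, ?_⟩⟩
    · rw [(hC' _).2 0 (by omega) (by omega), h0]
    · rw [(hC' _).1]
      exact congrArg g (h0 σ)
  choose A hA hA' using H
  refine ⟨fun b σ => A b σ - Finsupp.single 2 1 - Finsupp.single 2 1 - Finsupp.single 2 1,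
    fun b σ => by simp [(hA' b σ).1], ?_⟩
  refine (Realizable.testInput.bind fun b => Realizable.bind (hA b) fun _ =>
    Realizable.advance.bind fun _ => Realizable.emitRegister 2).mono ?_
  rintro s _ s' ⟨σ, ha, hb, rfl⟩
  refine ⟨_, _, ⟨rfl, rfl⟩, (), _, ⟨σ, ha, hb, rfl⟩, (), _, rfl, _, rfl, hb, ?_⟩
  rw [(hA' _ _).2]

/-- The sequence of states of a computation in stages, each of which reads one symbol. -/
def stageState {α : Type*} (f : Bool → α → α) (a₀ : α) (x : BinSeq) : ℕ → α
  | 0 => a₀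
  | s + 1 => f (x s) (stageState f a₀ x s)

/-- The number of symbols among the first entries of a sequence of optional symbols. -/
def symbolCount {β : Type*} (e : ℕ → Option β) : ℕ → ℕ
  | 0 => 0
  | s + 1 => symbolCount e s + if (e s).isSome then 1 else 0

/-- The flowchart of a stage is repeated forever. -/
theorem exists_machine_of_realizable {S : CounterState → CounterState → Prop}
    (h : Realizable (fun s (_ : Unit) s' => S s s')) :
    ∃ R : OracleMachine, R.IsType2 ∧ ∀ x, ∀ c : ℕ → CounterState,
      c 0 = ⟨x, 0, 1, 0, zeroSeq, 0⟩ → (∀ s, S (c s) (c (s + 1))) →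
      ∀ z, z ∈ R.type2Fun x ↔ (∀ K, ∃ s, K ≤ (c s).outHead) ∧
        ∀ s k, k < (c s).outHead → (c s).out k = z k := by
  obtain ⟨W, hW, entry, node, hp, H⟩ := h
  let φ : W ⊕ Unit → Fin 4 ⊕ W := Sum.elim .inr fun _ => .inr entry
  -- The initial vertices put a `1` into cell `0` of both working tapes. Writing moves the head
  -- right, so the first counter becomes `1`, the code of empty registers; the left move resets the
  -- second counter to `0`.
  let nd : Fin 4 ⊕ W → Instr (Fin 4 ⊕ W) := Sum.elim
    ![.start (.inl 1), .write 0 true (.inl 2), .write 1 true (.inl 3), .left 2 (.inr entry)]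
    fun w => (node w).map φ
  let R : OracleMachine :=
    { V := Fin 4 ⊕ W
      finite := inferInstance
      node := nd
      start := .inl 0
      node_start := by
        rintro (i | w)
        · fin_cases i <;> simp [nd]
        · constructor
          · rintro ⟨u, hu⟩
            have := (hp w).map φ
            simp only [nd, Sum.elim_inr] at hu
            rw [hu] at this
            exact this.elim
          · intro h; cases h
      start_source := by
        rintro (i | w)
        · fin_cases i <;> simp [nd, Instr.successors]
        · intro h
          obtain ⟨v, hv⟩ := Instr.mem_successors_map h
          rcases v with v | v <;> cases hv }
  refine ⟨R, ?_, fun x c h0 hc z => ?_⟩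
  · rintro (i | w) u₀ u₁
    · fin_cases i <;> simp [R, nd]
    · intro h
      have := (hp w).map φ
      simp only [R, nd, Sum.elim_inr] at h
      rw [h] at this
      exact this.elim
  refine (OracleMachine.sequential_plainStep (M := R)).yields_iff_of_chain
    (d := fun s => (c s).toConfig (.inr entry)) ?_ (fun s => ?_) z
  · have hz : Function.update zeroSeq 0 true = oneZeroSeq := by
      funext k
      by_cases hk : k = 0
      · subst hk; rfl
      · simp [zeroSeq, oneZeroSeq, hk]
    refine .head (b := ⟨.inl 1, ![x, zeroSeq, zeroSeq], ![0, 0, 0], zeroSeq, 0⟩) ?_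
      (.head (b := ⟨.inl 2, ![x, oneZeroSeq, zeroSeq], ![0, 1, 0], zeroSeq, 0⟩) ?_
      (.head (b := ⟨.inl 3, ![x, oneZeroSeq, oneZeroSeq], ![0, 1, 1], zeroSeq, 0⟩) ?_
      (.head ?_ .refl)))
    · refine congrArg some (Config.ext rfl ?_ ?_ rfl rfl) <;>
      · funext i; fin_cases i <;> rfl
    · refine congrArg some (Config.ext rfl ?_ ?_ rfl rfl)
      · funext i; fin_cases i <;> first | rfl | exact hz
      · funext i; fin_cases i <;> rfl
    · refine congrArg some (Config.ext rfl ?_ ?_ rfl rfl)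
      · funext i; fin_cases i <;> first | rfl | exact hz
      · funext i; fin_cases i <;> rfl
    · simp only [h0]
      refine congrArg some (Config.ext rfl rfl ?_ rfl rfl)
      funext i; fin_cases i <;> rfl
  · exact H R φ (fun w => rfl) _ () _ (hc s)

/-- Writing the two bits that encode a symbol. -/
def CounterState.emitSymbol (s : CounterState) : Option (Option Bool) → CounterState
  | none => s
  | some y => (s.emit y.isNone).emit (y.getD true)

theorem CounterState.emitCode_encode (s : CounterState) (y : Option (Option Bool)) :
    s.emitCode (Encodable.encode y) = s.emitSymbol y := by
  rcases y with _ | _ | _ | _ <;> rfl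

/-- For each stage computation on a countable type, there is a Type-2-Machine that performs it and
writes the codes of the symbols that it produces. -/
theorem exists_stageMachine {α : Type} [Primcodable α] (a₀ : α) (f : Bool → α → α)
    (hf : ∀ b, Primrec (f b)) (g : α → Option (Option Bool)) (hg : Primrec g) :
    ∃ R : OracleMachine, R.IsType2 ∧ ∀ x z, ∀ e : ℕ → Option (Option Bool),
      (∀ s, e s = g (stageState f a₀ x (s + 1))) →
      (z ∈ R.type2Fun x ↔ (∀ K, ∃ s, K ≤ symbolCount e s) ∧
        ∀ s y, e s = some y →
          z (2 * symbolCount e s) = y.isNone ∧ z (2 * symbolCount e s + 1) = y.getD true) := by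
  -- Codes are shifted by one, because the initial register content `0` has to represent `a₀`.
  let dec : ℕ → α := fun n => Nat.casesOn n a₀ fun k => (Encodable.decode k).getD a₀
  have hdec : Primrec dec := Primrec.nat_casesOn .id (.const a₀)
    (Primrec.option_getD.comp (Primrec.decode.comp .snd) (.const a₀))
  have dec_succ : ∀ a, dec (Encodable.encode a + 1) = a := fun a => by simp [dec]
  obtain ⟨T, hT, hR⟩ := Realizable.stage (fun b n => Encodable.encode (f b (dec n)) + 1)
    (fun b => Primrec.succ.comp (Primrec.encode.comp ((hf b).comp hdec)))
    (fun n => Encodable.encode (g (dec n))) (Primrec.encode.comp (hg.comp hdec))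
  obtain ⟨R, hR2, H⟩ := exists_machine_of_realizable hR
  refine ⟨R, hR2, fun x z e he => ?_⟩
  -- The counter states are tracked together with register contents that they encode, since
  -- `Realizable.stage` refers to the latter only existentially.
  let p : ℕ → CounterState × (ℕ →₀ ℕ) := fun s => Nat.rec (⟨x, 0, 1, 0, zeroSeq, 0⟩, 0)
    (fun s p => (CounterState.emitSymbol
      { p.1 with pos := p.1.pos + 1, a := registerCode (T (x s) p.2) } (e s), T (x s) p.2)) s
  have hp : ∀ s, p (s + 1) = (CounterState.emitSymbol
      { (p s).1 with pos := (p s).1.pos + 1, a := registerCode (T (x s) (p s).2) } (e s),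
      T (x s) (p s).2) := fun s => rfl
  have inv : ∀ s, (p s).1.input = x ∧ (p s).1.pos = s ∧ (p s).1.a = registerCode (p s).2 ∧
      (p s).1.b = 0 ∧ dec ((p s).2 0) = stageState f a₀ x s ∧
      (p s).1.outHead = 2 * symbolCount e s := by
    intro s
    induction s with
    | zero => exact ⟨rfl, rfl, registerCode_zero.symm, rfl, rfl, rfl⟩
    | succ s ih =>
      obtain ⟨h1, h2, h3, h4, h5, h6⟩ := ih
      have h7 : dec (T (x s) (p s).2 0) = stageState f a₀ x (s + 1) := by
        rw [hT, dec_succ, h5]; rfl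
      rw [hp]
      rcases hy : e s with _ | y
      · exact ⟨h1, by simp [CounterState.emitSymbol, h2], rfl, h4, h7, by
          simp [CounterState.emitSymbol, h6, symbolCount, hy]⟩
      · exact ⟨h1, by simp [CounterState.emitSymbol, CounterState.emit, h2], rfl, h4, h7, by
          simp [CounterState.emitSymbol, CounterState.emit, h6, symbolCount, hy]; ring⟩
  rw [H x (fun s => (p s).1) rfl ?_ z]
  swap
  · intro s
    obtain ⟨h1, h2, h3, h4, h5, h6⟩ := inv s
    refine ⟨(p s).2, h3, h4, ?_⟩
    rw [hp, CounterState.emitCode_encode, dec_succ, h5, he]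
    simp only [h1, h2]
    rfl
  refine and_congr ⟨fun h K => ?_, fun h K => ?_⟩ ⟨fun h s y hy => ?_, fun h s => ?_⟩
  · obtain ⟨s, hs⟩ := h (2 * K)
    have := (inv s).2.2.2.2.2
    exact ⟨s, by omega⟩
  · obtain ⟨s, hs⟩ := h K
    have := (inv s).2.2.2.2.2
    exact ⟨s, by omega⟩
  · have h6 := (inv s).2.2.2.2.2
    have h7 := h (s + 1)
    simp only [hp, hy, CounterState.emitSymbol, CounterState.emit, h6] at h7
    rw [← h7 _ (by omega), ← h7 _ (by omega)]
    simp
  · induction s with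
    | zero => intro k hk; exact absurd hk (Nat.not_lt_zero _)
    | succ s ih =>
      have h6 := (inv s).2.2.2.2.2
      intro k hk
      rcases hy : e s with _ | y
      · simp only [hp, hy, CounterState.emitSymbol] at hk ⊢
        exact ih k hk
      · obtain ⟨z1, z2⟩ := h s y hy
        simp only [hp, hy, CounterState.emitSymbol, CounterState.emit, h6] at hk ⊢
        rcases lt_trichotomy k (2 * symbolCount e s) with h8 | h8 | h8
        · rw [Function.update_of_ne (by omega), Function.update_of_ne (by omega)]
          exact ih k (by omega)
        · rw [Function.update_of_ne (by omega), h8, z1, Function.update_self]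
        · obtain rfl : k = 2 * symbolCount e s + 1 := by omega
          rw [z2, Function.update_self]

/-! ### Positions of the symbols produced -/

theorem symbolCount_mono {β : Type*} (e : ℕ → Option β) : Monotone (symbolCount e) :=
  monotone_nat_of_le_succ fun _ => Nat.le_add_right _ _

theorem symbolCount_lt {β : Type*} {e : ℕ → Option β} {s s' : ℕ} {y : β} (h : e s = some y)
    (hs : s < s') : symbolCount e s < symbolCount e s' :=
  lt_of_lt_of_le (by simp [symbolCount, h]) (symbolCount_mono e (Nat.succ_le_of_lt hs))

theorem eq_of_symbolCount_eq {β : Type*} {e : ℕ → Option β} {s s' : ℕ} {y y' : β}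
    (h : e s = some y) (h' : e s' = some y') (hs : symbolCount e s = symbolCount e s') : s = s' := by
  rcases lt_trichotomy s s' with h1 | h1 | h1
  · exact absurd hs (symbolCount_lt h h1).ne
  · exact h1
  · exact absurd hs (symbolCount_lt h' h1).ne'

theorem exists_symbolCount_eq {β : Type*} {e : ℕ → Option β}
    (h : ∀ K, ∃ s, K ≤ symbolCount e s) (j : ℕ) : ∃ s y, e s = some y ∧ symbolCount e s = j := by
  classical
  obtain ⟨s, hs, hmin⟩ : ∃ s, j + 1 ≤ symbolCount e s ∧ ∀ s' < s, ¬ j + 1 ≤ symbolCount e s' :=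
    ⟨Nat.find (h (j + 1)), Nat.find_spec (h (j + 1)), fun _ => Nat.find_min (h (j + 1))⟩
  rcases s with _ | s
  · simp [symbolCount] at hs
  · have h1 := hmin s (Nat.lt_succ_self s)
    rcases hy : e s with _ | y
    · simp [symbolCount, hy] at hs; omega
    · simp [symbolCount, hy] at hs
      exact ⟨s, y, hy, by omega⟩

/-- The values of a stage machine as a finitely revising computation. -/
theorem exists_revising_stageMachine {α : Type} [Primcodable α] (a₀ : α) (f : Bool → α → α)
    (hf : ∀ b, Primrec (f b)) (g : α → Option (Option Bool)) (hg : Primrec g) :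
    ∃ R : OracleMachine, R.IsType2 ∧ ∀ x y, ∀ e : ℕ → Option (Option Bool),
      (∀ s, e s = g (stageState f a₀ x (s + 1))) →
      ((∃ z ∈ R.type2Fun x, IsRevisingName z y) ↔
        (∀ K, ∃ s, K ≤ symbolCount e s) ∧ ∃ m,
          (∀ s k v, e s = some v → symbolCount e s = m + k → v = some (y k)) ∧
          ∀ s v, e s = some v → m = symbolCount e s + 1 → v = none) := by
  obtain ⟨R, hR, H⟩ := exists_stageMachine a₀ f hf g hg
  refine ⟨R, hR, fun x y e he => ?_⟩
  have decode : ∀ z, (∀ s y, e s = some y →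
      z (2 * symbolCount e s) = y.isNone ∧ z (2 * symbolCount e s + 1) = y.getD true) →
      ∀ s v, e s = some v → decodeMarks z (symbolCount e s) = v := by
    intro z hz s v hv
    obtain ⟨h1, h2⟩ := hz s v hv
    rcases v with _ | v <;> simp [decodeMarks, h1, h2]
  constructor
  · rintro ⟨z, hz, m, hm, hm'⟩
    obtain ⟨h1, h2⟩ := (H x z e he).1 hz
    refine ⟨h1, m, fun s k v hv hs => ?_, fun s v hv hs => ?_⟩
    · rw [← decode z h2 s v hv, hs, hm]
    · rw [← decode z h2 s v hv, hm' _ hs]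
  · rintro ⟨h1, m, hm, hm'⟩
    choose s v hv hs using exists_symbolCount_eq h1
    -- Every position `j` is filled at exactly one stage, so the symbols `v j` determine the whole
    -- binary output.
    let z : BinSeq := fun k => if k % 2 = 0 then (v (k / 2)).isNone else (v (k / 2)).getD true
    have hz : ∀ j, z (2 * j) = (v j).isNone ∧ z (2 * j + 1) = (v j).getD true := by
      intro j
      have h3 : (2 * j + 1) / 2 = j := by omega
      have h4 : (2 * j + 1) % 2 ≠ 0 := by omega
      constructor
      · simp [z]
      · simp only [z, if_neg h4, h3]
    have h2 : ∀ s y, e s = some y →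
        z (2 * symbolCount e s) = y.isNone ∧ z (2 * symbolCount e s + 1) = y.getD true := by
      intro s' y hy
      have := eq_of_symbolCount_eq hy (hv _) (hs (symbolCount e s')).symm
      have h3 := hv (symbolCount e s')
      rw [← this, hy] at h3
      rw [Option.some.inj h3]
      exact hz _
    refine ⟨z, (H x z e he).2 ⟨h1, h2⟩, m, fun k => ?_, fun j hj => ?_⟩
    · have := decode z h2 _ _ (hv (m + k))
      rw [hs] at this
      rw [this]
      exact hm _ _ _ (hv _) (hs _)
    · have := decode z h2 _ _ (hv j)
      rw [hs] at this
      rw [this]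
      exact hm' _ _ (hv j) (by rw [hs]; exact hj)

/-! ### Approximate computation with a limited number of steps -/

namespace OracleMachine

variable {M : OracleMachine}

namespace Sequential

variable {T : Config M.V → Config M.V → Prop}

theorem out_eq_of_yields (hT : Sequential T) {c : Config M.V} {w : BinSeq} (h : M.Yields T c w)
    {t k : ℕ} (hk : k < ((advance T)^[t] c).outHead) : ((advance T)^[t] c).out k = w k := by
  rcases (hT.yields_iff c w).1 h with ⟨t', ht', rfl⟩ | ⟨_, h⟩
  · rcases le_total t t' with h | h
    · exact (hT.out_eq c h hk).symm
    · rw [hT.iterate_eq_of_accept h ht']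
  · exact h t k hk

theorem exists_out_eq_of_yields (hT : Sequential T) {c : Config M.V} {w : BinSeq}
    (hc : ∀ k, c.outHead ≤ k → c.out k = false) (h : M.Yields T c w) {k : ℕ} (hk : w k = true) :
    ∃ t, k < ((advance T)^[t] c).outHead := by
  rcases (hT.yields_iff c w).1 h with ⟨t, ht, rfl⟩ | ⟨h, _⟩
  · refine ⟨t, lt_of_not_ge fun h' => ?_⟩
    rw [hT.out_false hc t k h'] at hk
    cases hk
  · exact h (k + 1)

/-- An accepting run is eventually stationary, so it cannot also write infinitely many symbols;
within either mode the output is determined by the unique run. -/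
theorem eq_of_yields (hT : Sequential T) {c : Config M.V} {w w' : BinSeq} (h : M.Yields T c w)
    (h' : M.Yields T c w') : w = w' := by
  rcases (hT.yields_iff c w).1 h with ⟨t, ht, hw⟩ | ⟨hK, hw⟩ <;>
  rcases (hT.yields_iff c w').1 h' with ⟨t', ht', hw'⟩ | ⟨hK', hw'⟩
  · rw [← hw, ← hw']
    rcases le_total t t' with h | h
    · rw [hT.iterate_eq_of_accept h ht]
    · rw [hT.iterate_eq_of_accept h ht']
  · funext k
    obtain ⟨t', ht'⟩ := hK' (max (k + 1) (((advance T)^[t] c).outHead + 1))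
    rcases le_total t t' with h | h
    · rw [hT.iterate_eq_of_accept h ht] at ht'
      omega
    · have := hT.outHead_mono c h
      simp only at this
      omega
  · funext k
    obtain ⟨t, ht⟩ := hK (max (k + 1) (((advance T)^[t'] c).outHead + 1))
    rcases le_total t' t with h | h
    · rw [hT.iterate_eq_of_accept h ht'] at ht
      omega
    · have := hT.outHead_mono c h
      simp only at this
      omega
  · funext k
    obtain ⟨t, ht⟩ := hK (k + 1)
    rw [← hw t k ht, ← hT.out_eq_of_yields h' ht]

/-- A run stuck at a vertex other than accept neither accepts nor moves its output head again. -/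
theorem step_of_yields (hT : Sequential T) {c : Config M.V} {w : BinSeq} (h : M.Yields T c w)
    {t : ℕ} (ht : M.node ((advance T)^[t] c).q ≠ .accept) :
    T ((advance T)^[t] c) ((advance T)^[t + 1] c) := by
  rw [Function.iterate_succ_apply']
  rcases advance_spec (T := T) ((advance T)^[t] c) with h' | ⟨_, h'⟩
  · exact h'
  · exfalso
    have fix : ∀ t' ≥ t, (advance T)^[t'] c = (advance T)^[t] c := by
      intro t' htt'
      obtain ⟨d, rfl⟩ := Nat.exists_eq_add_of_le' htt'
      rw [Function.iterate_add_apply, Function.iterate_fixed h']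
    rcases (hT.yields_iff c w).1 h with ⟨t', ht', _⟩ | ⟨hK, _⟩
    · rcases le_total t t' with h | h
      · rw [fix t' h] at ht'; exact ht ht'
      · rw [hT.iterate_eq_of_accept h ht'] at ht; exact ht ht'
    · obtain ⟨t', ht'⟩ := hK (((advance T)^[t] c).outHead + 1)
      rcases le_total t t' with h | h
      · rw [fix t' h] at ht'; omega
      · have := hT.outHead_mono c h
        simp only at this
        omega

open Classical in
-- The quantity bounded below is the one that enters `simResult`; after acceptance it is the budget
-- itself, since then the whole output tape is final.
theorem eventually_progress (hT : Sequential T) {c : Config M.V} {w : BinSeq}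
    (h : M.Yields T c w) (K : ℕ) :
    ∀ᶠ s in atTop, K ≤ if M.node ((advance T)^[s] c).q = .accept then s
      else ((advance T)^[s] c).outHead := by
  rcases (hT.yields_iff c w).1 h with ⟨t, ht, _⟩ | ⟨hK, _⟩
  · filter_upwards [eventually_ge_atTop (max t K)] with s hs
    rw [hT.iterate_eq_of_accept ((le_max_left _ _).trans hs) ht, if_pos ht]
    exact (le_max_right _ _).trans hs
  · obtain ⟨t, ht⟩ := hK K
    filter_upwards [eventually_ge_atTop (max t K)] with s hs
    split_ifs
    · exact (le_max_right _ _).trans hs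
    · exact ht.trans (hT.outHead_mono c ((le_max_left _ _).trans hs))

theorem exists_yields (hT : Sequential T) {c : Config M.V}
    (h : ∀ K, ∃ t, K ≤ ((advance T)^[t] c).outHead) : ∃ w, M.Yields T c w := by
  choose τ hτ using h
  refine ⟨fun k => ((advance T)^[τ (k + 1)] c).out k, (hT.yields_iff c _).2
    (.inr ⟨fun K => ⟨_, hτ K⟩, fun t k hk => ?_⟩)⟩
  rw [← hT.out_eq c (le_max_left t (τ (k + 1))) hk,
    ← hT.out_eq c (le_max_right t (τ (k + 1))) (hτ (k + 1))]

end Sequential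

/-! ### The transition relation with oracle `LPO` -/

theorem Yields.mono {T T' : Config M.V → Config M.V → Prop} (h : ∀ c c', T c c' → T' c c')
    {c : Config M.V} {w : BinSeq} (hy : M.Yields T c w) : M.Yields T' c w := by
  rcases hy with ⟨c', h1, h2⟩ | ⟨d, h1, h2⟩
  · exact .inl ⟨c', Relation.ReflTransGen.mono h _ _ h1, h2⟩
  · exact .inr ⟨d, fun m hm => ⟨Relation.ReflTransGen.mono h _ _ (h1 m hm).1, (h1 m hm).2⟩, h2⟩

/-- The transition relation with oracle `LPO`. -/
abbrev LPOStep (M : OracleMachine) (m : ℕ) : Config M.V → Config M.V → Prop :=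
  M.Step (fun w => {LPO w}) m

theorem next_of_query {c : Config M.V} {v₀ v₁ : M.V} (h : M.node c.q = .query v₀ v₁) :
    M.next c = none := by simp [next, h]

theorem lpoStep_of_not_query {m : ℕ} {c c' : Config M.V}
    (h : ∀ v₀ v₁, M.node c.q ≠ .query v₀ v₁) : M.LPOStep m c c' ↔ M.next c = some c' := by
  induction m with
  | zero => rfl
  | succ m ih =>
    constructor
    · rintro (h' | ⟨v₀, v₁, _, _, hq, _⟩)
      · exact ih.1 h'
      · exact absurd hq (h v₀ v₁)
    · intro h'
      exact .inl (ih.2 h')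

theorem not_lpoStep_zero {c c' : Config M.V} {v₀ v₁ : M.V} (h : M.node c.q = .query v₀ v₁) :
    ¬ M.LPOStep 0 c c' := by
  intro h'
  have : M.next c = some c' := h'
  rw [next_of_query h] at this
  cases this

/-- Depth `m + 1` also admits answers obtained with smaller depth, but an output yielded with
smaller depth is yielded with depth `m` too. -/
theorem lpoStep_succ_of_query {m : ℕ} {c c' : Config M.V} {v₀ v₁ : M.V}
    (h : M.node c.q = .query v₀ v₁) : M.LPOStep (m + 1) c c' ↔
      ∃ w, M.Yields (M.LPOStep m) (M.spawn c v₁) w ∧ c' = M.receive c v₀ (LPO w) := by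
  induction m with
  | zero =>
    constructor
    · rintro (h' | ⟨u₀, u₁, w, y, hq, hw, rfl, rfl⟩)
      · exact absurd h' (not_lpoStep_zero h)
      · rw [h] at hq; cases hq
        exact ⟨w, hw, rfl⟩
    · rintro ⟨w, hw, rfl⟩
      exact .inr ⟨v₀, v₁, w, _, h, hw, rfl, rfl⟩
  | succ m ih =>
    constructor
    · rintro (h' | ⟨u₀, u₁, w, y, hq, hw, rfl, rfl⟩)
      · obtain ⟨w, hw, hc⟩ := ih.1 h'
        exact ⟨w, hw.mono fun _ _ h => .inl h, hc⟩
      · rw [h] at hq; cases hq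
        exact ⟨w, hw, rfl⟩
    · rintro ⟨w, hw, rfl⟩
      exact .inr ⟨v₀, v₁, w, _, h, hw, rfl, rfl⟩

/-- Determinism at depth `m + 1` rests on uniqueness of the output of a query at depth `m`, together
with `LPO` being single-valued. -/
theorem sequential_lpoStep (m : ℕ) : Sequential (M.LPOStep m) := by
  have nonquery : ∀ {m c c'}, (∀ v₀ v₁, M.node c.q ≠ .query v₀ v₁) → M.LPOStep m c c' →
      M.PlainStep c c' := fun h h' => (lpoStep_of_not_query h).1 h'
  induction m with
  | zero => exact sequential_plainStep
  | succ m ih =>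
    refine ⟨fun {a b c} hb hc => ?_, fun {c c'} h => ?_, fun {c c'} ha h => ?_⟩
    · by_cases hq : ∃ v₀ v₁, M.node a.q = .query v₀ v₁
      · obtain ⟨v₀, v₁, hq⟩ := hq
        obtain ⟨w, hw, rfl⟩ := (lpoStep_succ_of_query hq).1 hb
        obtain ⟨w', hw', rfl⟩ := (lpoStep_succ_of_query hq).1 hc
        rw [ih.eq_of_yields hw hw']
      · push Not at hq
        exact sequential_plainStep.det (nonquery hq hb) (nonquery hq hc)
    · by_cases hq : ∃ v₀ v₁, M.node c.q = .query v₀ v₁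
      · obtain ⟨v₀, v₁, hq⟩ := hq
        obtain ⟨w, hw, rfl⟩ := (lpoStep_succ_of_query hq).1 h
        exact .inl ⟨rfl, rfl⟩
      · push Not at hq
        exact sequential_plainStep.output (nonquery hq h)
    · exact sequential_plainStep.accept ha (nonquery (by rw [ha]; simp) h)

theorem advance_of_not_query {m : ℕ} {c : Config M.V}
    (h : ∀ v₀ v₁, M.node c.q ≠ .query v₀ v₁) :
    advance (M.LPOStep m) c = (M.next c).getD c := by
  rcases hn : M.next c with _ | c'
  · refine advance_of_not fun c' h' => ?_
    rw [lpoStep_of_not_query h, hn] at h'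
    cases h'
  · exact (sequential_lpoStep m).advance_eq ((lpoStep_of_not_query h).2 hn)

/-! ### Approximate answers and the call log -/

open Classical in
/-- Whether a `1` has been written on the output tape. -/
noncomputable def hasOne (c : Config M.V) : Bool := decide (∃ k < c.outHead, c.out k = true)

/-- The answer of the oracle `LPO` to a query, given whether the query contains a `1`. -/
def answerSeq (b : Bool) : BinSeq := if b then oneZeroSeq else zeroSeq

open Classical in
theorem LPO_eq_answerSeq (w : BinSeq) : LPO w = answerSeq (decide (w ≠ zeroSeq)) := by
  by_cases h : w = zeroSeq <;> simp [LPO, answerSeq, h]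

open Classical in
-- If `w` is `0^ℕ`, no `1` is ever written; otherwise a `1` is visible once the head has passed its
-- cell. The latter happens even in accepting runs, because unwritten cells contain `0`.
theorem Sequential.eventually_hasOne {T : Config M.V → Config M.V → Prop} (hT : Sequential T)
    {c : Config M.V} {w : BinSeq} (hc : ∀ k, c.outHead ≤ k → c.out k = false)
    (h : M.Yields T c w) :
    ∀ᶠ s in atTop, hasOne ((advance T)^[s] c) = decide (w ≠ zeroSeq) := by
  by_cases hw : w = zeroSeq
  · refine Eventually.of_forall fun s => ?_
    simp only [hasOne, hw, ne_eq, not_true_eq_false, decide_false, decide_eq_false_iff_not]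
    rintro ⟨k, hk, hk'⟩
    rw [hT.out_eq_of_yields h hk, hw] at hk'
    cases hk'
  · obtain ⟨k, hk⟩ : ∃ k, w k = true := by
      by_contra h'
      push Not at h'
      exact hw (funext fun k => Bool.eq_false_of_not_eq_true (h' k))
    obtain ⟨t, ht⟩ := hT.exists_out_eq_of_yields hc h hk
    filter_upwards [eventually_ge_atTop t] with s hs
    have := ht.trans_le (hT.outHead_mono c hs)
    simp only [hasOne, hw, ne_eq, not_false_eq_true, decide_true, decide_eq_true_eq]
    exact ⟨k, this, by rw [hT.out_eq_of_yields h this, hk]⟩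

/-- The oracle calls made so far, the latest first: the code of the calls made in the computation of
the query, together with the answer given. -/
abbrev CallLog : Type := List (ℕ × Bool)

/-- One step of the approximate computation, in which a query is answered by `ask`. Besides the
configuration, the state contains the calls made so far and a lower bound for the progress in the
computation of all queries posed so far. -/
def simStep (ask : Config M.V → Option ((ℕ × Bool) × ℕ)) (r : Config M.V × CallLog × ℕ) :
    Config M.V × CallLog × ℕ :=
  match M.node r.1.q with
  | .query v₀ v₁ =>
    match ask (M.spawn r.1 v₁) with
    | none => r
    | some (e, p) => (M.receive r.1 v₀ (answerSeq e.2), e :: r.2.1, min r.2.2 p)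
  | _ => ((M.next r.1).getD r.1, r.2)

open Classical in
/-- The calls, the presence of a `1` in the output, and the progress after `s` steps. -/
noncomputable def simResult (s : ℕ) (r : Config M.V × CallLog × ℕ) : (ℕ × Bool) × ℕ :=
  ((Encodable.encode r.2.1, hasOne r.1),
    min r.2.2 (if M.node r.1.q = .accept then s else r.1.outHead))

/-- The approximate answer with query depth `m` to the query computed from a configuration, on the
basis of `s` steps. -/
noncomputable def ask (M : OracleMachine) : ℕ → ℕ → Config M.V → Option ((ℕ × Bool) × ℕ)
  | 0, _, _ => none
  | m + 1, s, c => some (simResult s ((simStep (ask M m s))^[s] (c, [], s)))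

/-- The approximate computation with query depth `m` after `t` steps, where queries are answered on
the basis of `s` steps. -/
noncomputable def sim (M : OracleMachine) (m s t : ℕ) (c : Config M.V) :
    Config M.V × CallLog × ℕ :=
  (simStep (M.ask m s))^[t] (c, [], s)

theorem sim_succ (m s t : ℕ) (c : Config M.V) :
    M.sim m s (t + 1) c = simStep (M.ask m s) (M.sim m s t c) :=
  Function.iterate_succ_apply' _ _ _

theorem simStep_of_not_query {ask : Config M.V → Option ((ℕ × Bool) × ℕ)}
    {r : Config M.V × CallLog × ℕ} (h : ∀ v₀ v₁, M.node r.1.q ≠ .query v₀ v₁) :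
    simStep ask r = ((M.next r.1).getD r.1, r.2) := by
  unfold simStep
  split
  · exact absurd ‹_› (h _ _)
  · rfl

theorem simStep_of_query {ask : Config M.V → Option ((ℕ × Bool) × ℕ)}
    {r : Config M.V × CallLog × ℕ} {v₀ v₁ : M.V} (h : M.node r.1.q = .query v₀ v₁) :
    simStep ask r = match ask (M.spawn r.1 v₁) with
      | none => r
      | some (e, p) => (M.receive r.1 v₀ (answerSeq e.2), e :: r.2.1, min r.2.2 p) := by
  unfold simStep
  rw [h]

theorem simStep_query_zero {s : ℕ} {r : Config M.V × CallLog × ℕ} {v₀ v₁ : M.V}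
    (h : M.node r.1.q = .query v₀ v₁) : simStep (M.ask 0 s) r = r := by
  rw [simStep_of_query h]; rfl

theorem simStep_query_succ {m s : ℕ} {r : Config M.V × CallLog × ℕ} {v₀ v₁ : M.V}
    (h : M.node r.1.q = .query v₀ v₁) :
    simStep (M.ask (m + 1) s) r =
      let a := simResult s (M.sim m s s (M.spawn r.1 v₁))
      (M.receive r.1 v₀ (answerSeq a.1.2), a.1 :: r.2.1, min r.2.2 a.2) := by
  rw [simStep_of_query h]; rfl

theorem simStep_grows (ask : Config M.V → Option ((ℕ × Bool) × ℕ))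
    (r : Config M.V × CallLog × ℕ) :
    r.2.1 <:+ (simStep ask r).2.1 ∧ (simStep ask r).2.2 ≤ r.2.2 := by
  by_cases hq : ∃ v₀ v₁, M.node r.1.q = .query v₀ v₁
  · obtain ⟨v₀, v₁, hq⟩ := hq
    rw [simStep_of_query hq]
    split
    · exact ⟨List.suffix_rfl, le_rfl⟩
    · exact ⟨List.suffix_cons _ _, min_le_left _ _⟩
  · push Not at hq
    rw [simStep_of_not_query hq]
    exact ⟨List.suffix_rfl, le_rfl⟩

theorem sim_grows {m s t t' : ℕ} (h : t ≤ t') (c : Config M.V) :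
    (M.sim m s t c).2.1 <:+ (M.sim m s t' c).2.1 ∧ (M.sim m s t' c).2.2 ≤ (M.sim m s t c).2.2 := by
  induction t', h using Nat.le_induction with
  | base => exact ⟨List.suffix_rfl, le_rfl⟩
  | succ t' _ ih =>
    rw [sim_succ]
    have := simStep_grows (M.ask m s) (M.sim m s t' c)
    exact ⟨ih.1.trans this.1, this.2.trans ih.2⟩

theorem spawn_out_false (c : Config M.V) (v : M.V) :
    ∀ k, (M.spawn c v).outHead ≤ k → (M.spawn c v).out k = false := fun _ _ => rfl

/-- A yielding computation with finitely many calls poses no queries after some time. -/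
theorem exists_forall_not_query {m : ℕ} {c : Config M.V} {w : BinSeq}
    (hy : M.Yields (M.LPOStep m) c w) (hf : M.FinitelyManyCallsFrom (fun w => {LPO w}) m c) :
    ∃ t₁, ∀ t ≥ t₁, ∀ v₀ v₁, M.node ((advance (M.LPOStep m))^[t] c).q ≠ .query v₀ v₁ := by
  have hT := sequential_lpoStep (M := M) m
  have step : ∀ t v₀ v₁, M.node ((advance (M.LPOStep m))^[t] c).q = .query v₀ v₁ →
      M.LPOStep m ((advance (M.LPOStep m))^[t] c) ((advance (M.LPOStep m))^[t + 1] c) :=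
    fun t v₀ v₁ h => hT.step_of_yields hy (by rw [h]; simp)
  rcases m with _ | m
  · exact ⟨0, fun t _ v₀ v₁ h => not_lpoStep_zero h (step t v₀ v₁ h)⟩
  · obtain ⟨⟨N, hN⟩, _⟩ := hf
    by_contra hcon
    push Not at hcon
    -- Along the orbit the number of calls never decreases; infinitely many query vertices would
    -- therefore exceed any bound `N`.
    have run : ∀ t t' k, M.CountedRun (fun w => {LPO w}) (m + 1) c
        ((advance (M.LPOStep (m + 1)))^[t] c) k → t ≤ t' → ∃ k' ≥ k, M.CountedRun
        (fun w => {LPO w}) (m + 1) c ((advance (M.LPOStep (m + 1)))^[t'] c) k' := by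
      intro t t' k hk htt'
      induction t', htt' using Nat.le_induction with
      | base => exact ⟨k, le_rfl, hk⟩
      | succ t' _ ih =>
        obtain ⟨k', hk', hr⟩ := ih
        by_cases hq : ∃ v₀ v₁, M.node ((advance (M.LPOStep (m + 1)))^[t'] c).q = .query v₀ v₁
        · exact ⟨k' + 1, by omega, hr.call hq (step _ _ _ hq.choose_spec.choose_spec)⟩
        · push Not at hq
          refine ⟨k', hk', ?_⟩
          rcases advance_spec (T := M.LPOStep (m + 1)) ((advance (M.LPOStep (m + 1)))^[t'] c)
            with h | ⟨_, h⟩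
          · rw [Function.iterate_succ_apply']
            exact hr.plain hq h
          · rwa [Function.iterate_succ_apply', h]
    have many : ∀ k, ∃ t, ∃ k' ≥ k, M.CountedRun (fun w => {LPO w}) (m + 1) c
        ((advance (M.LPOStep (m + 1)))^[t] c) k' := by
      intro k
      induction k with
      | zero => exact ⟨0, 0, le_rfl, .refl⟩
      | succ k ih =>
        obtain ⟨t, k', hk', hr⟩ := ih
        obtain ⟨t', htt', v₀, v₁, hq⟩ := hcon t
        obtain ⟨k'', hk'', hr'⟩ := run t t' k' hr htt'
        exact ⟨t' + 1, k'' + 1, by omega, hr'.call ⟨v₀, v₁, hq⟩ (step _ _ _ hq)⟩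
    obtain ⟨t, k', hk', hr⟩ := many (N + 1)
    have := hN _ _ hr
    omega

/-- If the computation yields an output and makes only finitely many calls, then the approximations
are eventually correct. -/
theorem eventually_sim (m : ℕ) : ∀ {c : Config M.V} {w : BinSeq}, M.Yields (M.LPOStep m) c w →
    M.FinitelyManyCallsFrom (fun w => {LPO w}) m c →
    ∃ L, (∀ᶠ s in atTop, (∀ t, (M.sim m s t c).1 = (advance (M.LPOStep m))^[t] c) ∧
      (M.sim m s s c).2.1 = L) ∧
      ∀ K, ∀ᶠ s in atTop, K ≤ (simResult s (M.sim m s s c)).2 := by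
  induction m using Nat.strong_induction_on with
  | _ m ih =>
  intro c w hy hf
  have hT := sequential_lpoStep (M := M) m
  -- For each fixed time `t` only finitely many queries have occurred, so a common threshold for the
  -- budget exists. The number of steps inside those queries still grows with `s`.
  have main : ∀ t, ∃ L, (∀ᶠ s in atTop,
      (∀ t' ≤ t, (M.sim m s t' c).1 = (advance (M.LPOStep m))^[t'] c) ∧
      (M.sim m s t c).2.1 = L) ∧ ∀ K, ∀ᶠ s in atTop, K ≤ (M.sim m s t c).2.2 := by
    intro t
    induction t with
    | zero =>
      refine ⟨[], Eventually.of_forall fun s => ⟨fun t' ht' => ?_, rfl⟩,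
        fun K => eventually_ge_atTop K⟩
      obtain rfl := Nat.le_zero.1 ht'
      rfl
    | succ t iht =>
      obtain ⟨L, hL, hK⟩ := iht
      by_cases hq : ∃ v₀ v₁, M.node ((advance (M.LPOStep m))^[t] c).q = .query v₀ v₁
      · obtain ⟨v₀, v₁, hq⟩ := hq
        have hstep := hT.step_of_yields hy (t := t) (by rw [hq]; simp)
        rcases m with _ | m
        · exact absurd hstep (not_lpoStep_zero hq)
        · obtain ⟨w', hw', hc'⟩ := (lpoStep_succ_of_query hq).1 hstep
          obtain ⟨L', hL', hK'⟩ := ih m (Nat.lt_succ_self m) hw'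
            (hf.2 _ _ _ (reflTransGen_iterate c t) hq)
          have h1 := (sequential_lpoStep m).eventually_hasOne (spawn_out_false _ _) hw'
          classical
          refine ⟨(Encodable.encode L', decide (w' ≠ zeroSeq)) :: L, ?_, fun K => ?_⟩
          · filter_upwards [hL, hL', h1] with s hs hs' h1
            have hq' : M.node (M.sim (m + 1) s t c).1.q = .query v₀ v₁ := by rwa [hs.1 t le_rfl]
            have hst := simStep_query_succ (s := s) (m := m) hq'
            rw [← sim_succ] at hst
            simp only [hs.1 t le_rfl, simResult, hs'.2, hs'.1, h1, hs.2] at hst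
            refine ⟨fun t' ht' => ?_, by rw [hst]⟩
            rcases Nat.le_succ_iff.1 ht' with h | rfl
            · exact hs.1 t' h
            · rw [hst, hc', LPO_eq_answerSeq]
          · filter_upwards [hL, hK K, hK' K] with s hs hk hk'
            have hq' : M.node (M.sim (m + 1) s t c).1.q = .query v₀ v₁ := by rwa [hs.1 t le_rfl]
            rw [sim_succ, simStep_query_succ hq']
            refine le_min hk ?_
            rwa [hs.1 t le_rfl]
      · push Not at hq
        have key : ∀ s, (M.sim m s t c).1 = (advance (M.LPOStep m))^[t] c →
            M.sim m s (t + 1) c = ((advance (M.LPOStep m))^[t + 1] c, (M.sim m s t c).2) := by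
          intro s hs
          rw [sim_succ, simStep_of_not_query (by rwa [hs]), hs, Function.iterate_succ_apply',
            advance_of_not_query hq]
        refine ⟨L, ?_, fun K => ?_⟩
        · filter_upwards [hL] with s hs
          rw [key s (hs.1 t le_rfl)]
          refine ⟨fun t' ht' => ?_, hs.2⟩
          rcases Nat.le_succ_iff.1 ht' with h | rfl
          · exact hs.1 t' h
          · rw [key s (hs.1 t le_rfl)]
        · filter_upwards [hL, hK K] with s hs hk
          rwa [key s (hs.1 t le_rfl)]
  -- After `t₁` no query occurs and approximation and true run proceed identically, so the threshold
  -- for `t₁` serves all later times.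
  obtain ⟨t₁, ht₁⟩ := exists_forall_not_query hy hf
  obtain ⟨L, hL, hK⟩ := main t₁
  have later : ∀ s, (M.sim m s t₁ c).1 = (advance (M.LPOStep m))^[t₁] c → ∀ t ≥ t₁,
      M.sim m s t c = ((advance (M.LPOStep m))^[t] c, (M.sim m s t₁ c).2) := by
    intro s hs t ht
    induction t, ht using Nat.le_induction with
    | base => rw [← hs]
    | succ t ht iht =>
      have hq := ht₁ t ht
      rw [sim_succ, simStep_of_not_query (by rwa [iht]), iht, Function.iterate_succ_apply',
        advance_of_not_query hq]
  refine ⟨L, ?_, fun K => ?_⟩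
  · filter_upwards [hL, eventually_ge_atTop t₁] with s hs hst
    refine ⟨fun t => ?_, ?_⟩
    · rcases le_total t t₁ with h | h
      · exact hs.1 t h
      · rw [later s (hs.1 _ le_rfl) t h]
    · rw [later s (hs.1 _ le_rfl) s hst, ← hs.2]
  · filter_upwards [hL, hK K, hT.eventually_progress hy K, eventually_ge_atTop t₁]
      with s hs hk hp hst
    rw [later s (hs.1 _ le_rfl) s hst]
    exact le_min hk hp

/-- If the calls made by the approximations stabilize and there is progress in all computations,
then the approximations are correct. -/
theorem sim_correct (m : ℕ) : ∀ {c : Config M.V} {L : CallLog} {s₀ : ℕ},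
    (∀ s ≥ s₀, (M.sim m s s c).2.1 = L) →
    (∀ K, ∃ᶠ s in atTop, K ≤ (simResult s (M.sim m s s c)).2) →
    M.FinitelyManyCallsFrom (fun w => {LPO w}) m c ∧ (∃ w, M.Yields (M.LPOStep m) c w) ∧
      ∀ s ≥ s₀, ∀ t ≤ s, (M.sim m s t c).1 = (advance (M.LPOStep m))^[t] c := by
  induction m using Nat.strong_induction_on with
  | _ m ih =>
  intro c L s₀ hL hK
  have hT := sequential_lpoStep (M := M) m
  -- The inductive step at a query: a constant log forces the answer to be constant, and the
  -- induction hypothesis at smaller depth shows that it is correct.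
  have query : ∀ t ℓ, (∀ s ≥ s₀, t ≤ s →
      (M.sim m s t c).1 = (advance (M.LPOStep m))^[t] c ∧ (M.sim m s t c).2.1 = ℓ) →
      ∀ v₀ v₁, M.node ((advance (M.LPOStep m))^[t] c).q = .query v₀ v₁ → ∀ m', m = m' + 1 →
      M.FinitelyManyCallsFrom (fun w => {LPO w}) m'
        (M.spawn ((advance (M.LPOStep m))^[t] c) v₁) ∧
      ∃ ℓ', ∀ s ≥ s₀, t + 1 ≤ s →
        (M.sim m s (t + 1) c).1 = (advance (M.LPOStep m))^[t + 1] c ∧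
        (M.sim m s (t + 1) c).2.1 = ℓ' := by
    rintro t ℓ hℓ v₀ v₁ hq m' rfl
    set d := M.spawn ((advance (M.LPOStep (m' + 1)))^[t] c) v₁ with hd
    have hst : ∀ s ≥ s₀, t ≤ s → M.sim (m' + 1) s (t + 1) c =
        (M.receive ((advance (M.LPOStep (m' + 1)))^[t] c) v₀
          (answerSeq (simResult s (M.sim m' s s d)).1.2),
          (simResult s (M.sim m' s s d)).1 :: ℓ,
          min (M.sim (m' + 1) s t c).2.2 (simResult s (M.sim m' s s d)).2) := by
      intro s hs hts
      obtain ⟨h1, h2⟩ := hℓ s hs hts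
      rw [sim_succ, simStep_query_succ (by rwa [h1]), h1, h2]
    -- From this budget on, the run is long enough for the call at time `t` to be in the final log.
    set s₁ := max s₀ (t + 1) with hs₁
    have hs₁' : ∀ {s}, s₁ ≤ s → s₀ ≤ s ∧ t + 1 ≤ s := fun {s} h => by omega
    have suf : ∀ s ≥ s₁, (simResult s (M.sim m' s s d)).1 :: ℓ <:+ L := by
      intro s hs
      have := (sim_grows (m := m' + 1) (s := s) (hs₁' hs).2 c).1
      rwa [hL s (hs₁' hs).1, hst s (hs₁' hs).1 (by have := (hs₁' hs).2; omega)] at this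
    -- The entry together with the earlier log is a suffix of `L` of a length independent of `s`,
    -- hence always the same suffix.
    have const : ∀ s ≥ s₁, (simResult s (M.sim m' s s d)).1 =
        (simResult s₁ (M.sim m' s₁ s₁ d)).1 := by
      intro s hs
      have h1 := List.suffix_of_suffix_length_le (suf s hs) (suf s₁ le_rfl) (by simp)
      have h2 := h1.eq_of_length (by simp)
      exact (List.cons.inj h2).1
    obtain ⟨hF, ⟨w, hw⟩, hconf⟩ := ih m' (Nat.lt_succ_self m') (c := d)
      (L := (M.sim m' s₁ s₁ d).2.1) (s₀ := s₁)
      (fun s hs => Encodable.encode_injective (congrArg Prod.fst (const s hs)))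
      -- The progress of the main computation is a minimum that includes the progress of this query,
      -- so the latter is unbounded as well.
      (fun K => by
        refine ((hK K).and_eventually (eventually_ge_atTop s₁)).mono ?_
        rintro s ⟨hs, hs'⟩
        have h1 := (sim_grows (m := m' + 1) (s := s) (hs₁' hs').2 c).2
        rw [hst s (hs₁' hs').1 (by have := (hs₁' hs').2; omega)] at h1
        exact hs.trans ((min_le_left _ _).trans (h1.trans (min_le_right _ _))))
    classical
    -- The constant answer agrees with the true one at some large budget, hence at every budget from
    -- `s₁` on.
    have hans : (simResult s₁ (M.sim m' s₁ s₁ d)).1.2 = decide (w ≠ zeroSeq) := by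
      obtain ⟨s, hs, hs'⟩ := (((sequential_lpoStep m').eventually_hasOne
        (spawn_out_false _ _) hw).and (eventually_ge_atTop s₁)).exists
      rw [← const s hs', ← hs]
      exact congrArg hasOne (hconf s hs' s le_rfl)
    refine ⟨hF, (simResult s₁ (M.sim m' s₁ s₁ d)).1 :: ℓ, fun s hs hts => ?_⟩
    have hss : s₁ ≤ s := max_le hs hts
    rw [hst s hs (by omega), const s hss, hans, ← LPO_eq_answerSeq]
    refine ⟨?_, rfl⟩
    rw [Function.iterate_succ_apply']
    exact (hT.advance_eq ((lpoStep_succ_of_query hq).2 ⟨w, hw, rfl⟩)).symm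
  have main : ∀ t, ∃ ℓ, ∀ s ≥ s₀, t ≤ s →
      (M.sim m s t c).1 = (advance (M.LPOStep m))^[t] c ∧ (M.sim m s t c).2.1 = ℓ := by
    intro t
    induction t with
    | zero => exact ⟨[], fun s _ _ => ⟨rfl, rfl⟩⟩
    | succ t iht =>
      obtain ⟨ℓ, hℓ⟩ := iht
      by_cases hq : ∃ v₀ v₁, M.node ((advance (M.LPOStep m))^[t] c).q = .query v₀ v₁
      · obtain ⟨v₀, v₁, hq⟩ := hq
        rcases m with _ | m
        · refine ⟨ℓ, fun s hs hts => ?_⟩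
          obtain ⟨h1, h2⟩ := hℓ s hs (by omega)
          rw [sim_succ, simStep_query_zero (by rwa [h1]), Function.iterate_succ_apply',
            advance_of_not fun _ => not_lpoStep_zero hq]
          exact ⟨h1, h2⟩
        · exact (query t ℓ hℓ v₀ v₁ hq m rfl).2
      · push Not at hq
        refine ⟨ℓ, fun s hs hts => ?_⟩
        obtain ⟨h1, h2⟩ := hℓ s hs (by omega)
        rw [sim_succ, simStep_of_not_query (by rwa [h1]), Function.iterate_succ_apply',
          advance_of_not_query hq, h1]
        exact ⟨rfl, h2⟩
  refine ⟨?_, ?_, fun s hs t hts => ((main t).choose_spec s hs hts).1⟩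
  · rcases m with _ | m
    · trivial
    · refine ⟨⟨L.length, fun c' k hr => ?_⟩, fun c' v₀ v₁ hc' hq => ?_⟩
      -- The number of calls of a run prefix is the length of the log at that time, which is at most
      -- the length of `L`.
      · obtain ⟨t, rfl, ht⟩ : ∃ t, (advance (M.LPOStep (m + 1)))^[t] c = c' ∧ ∀ s ≥ s₀, t ≤ s →
            (M.sim (m + 1) s t c).2.1.length = k := by
          induction hr with
          | refl => exact ⟨0, rfl, fun s _ _ => rfl⟩
          | @plain c₁ c₂ k hr hq hs ihr =>
            obtain ⟨t, rfl, ht⟩ := ihr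
            refine ⟨t + 1, by rw [Function.iterate_succ_apply', hT.advance_eq hs],
              fun s hs hts => ?_⟩
            have := ((main t).choose_spec s hs (by omega)).1
            rw [sim_succ, simStep_of_not_query (by rwa [this])]
            exact ht s hs (by omega)
          | @call c₁ c₂ k hr hq hs ihr =>
            obtain ⟨t, rfl, ht⟩ := ihr
            obtain ⟨v₀, v₁, hq⟩ := hq
            refine ⟨t + 1, by rw [Function.iterate_succ_apply', hT.advance_eq hs],
              fun s hs hts => ?_⟩
            have := ((main t).choose_spec s hs (by omega)).1
            rw [sim_succ, simStep_query_succ (by rwa [this])]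
            simp [ht s hs (by omega)]
        have h1 := (sim_grows (m := m + 1) (s := max s₀ t) (le_max_right s₀ t) c).1.length_le
        rwa [ht _ (le_max_left _ _) (le_max_right _ _), hL _ (le_max_left _ _)] at h1
      · obtain ⟨t, rfl⟩ := hT.exists_iterate hc'
        obtain ⟨ℓ, hℓ⟩ := main t
        exact (query t ℓ hℓ v₀ v₁ hq m rfl).1
  · by_cases ha : ∃ t, M.node ((advance (M.LPOStep m))^[t] c).q = .accept
    · obtain ⟨t, ht⟩ := ha
      exact ⟨_, .inl ⟨_, reflTransGen_iterate c t, ht, rfl⟩⟩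
    · refine hT.exists_yields fun K => ?_
      obtain ⟨s, hs, hs'⟩ := ((hK K).and_eventually (eventually_ge_atTop s₀)).exists
      have h1 := ((main s).choose_spec s hs' le_rfl).1
      refine ⟨s, hs.trans ((min_le_right _ _).trans ?_)⟩
      rw [h1, if_neg fun h => ha ⟨s, h⟩]

end OracleMachine

/-! ### Producing a finitely revising name -/

/-- The sequence `e` of symbols is produced from approximations: a mark whenever the information `ℓ`
differs from the information `last` used before, and otherwise the bit with number `count` of the
current approximation `o` if the progress `P` permits it. -/
structure RevisingOutput {Λ : Type*} (ℓ : ℕ → Λ) (P : ℕ → ℕ) (o : ℕ → ℕ → Bool) (last : ℕ → Λ)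
    (count : ℕ → ℕ) (e : ℕ → Option (Option Bool)) : Prop where
  zero : count 0 = 0
  succ : ∀ s,
    (ℓ s ≠ last s ∧ last (s + 1) = ℓ s ∧ count (s + 1) = 0 ∧ e s = some none) ∨
    (ℓ s = last s ∧ count s < P s ∧ last (s + 1) = last s ∧ count (s + 1) = count s + 1 ∧
      e s = some (some (o s (count s)))) ∨
    (ℓ s = last s ∧ P s ≤ count s ∧ last (s + 1) = last s ∧ count (s + 1) = count s ∧ e s = none)

namespace RevisingOutput

variable {Λ : Type*} {ℓ : ℕ → Λ} {P : ℕ → ℕ} {o : ℕ → ℕ → Bool} {last : ℕ → Λ} {count : ℕ → ℕ}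
  {e : ℕ → Option (Option Bool)}

theorem count_le (h : RevisingOutput ℓ P o last count e) (s : ℕ) : count s ≤ symbolCount e s := by
  induction s with
  | zero => exact h.zero.le
  | succ s ih =>
    rcases h.succ s with ⟨_, _, h3, h4⟩ | ⟨_, _, _, h3, h4⟩ | ⟨_, _, _, h3, h4⟩ <;>
      simp [symbolCount, h3, h4] <;> omega

/-- As long as there is no mark, every symbol is counted. -/
theorem symbolCount_add_eq (h : RevisingOutput ℓ P o last count e) {s₀ : ℕ}
    (hm : ∀ s ≥ s₀, e s ≠ some none) {s : ℕ} (hs : s₀ ≤ s) :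
    symbolCount e s + count s₀ = symbolCount e s₀ + count s ∧ last s = last s₀ := by
  induction s, hs using Nat.le_induction with
  | base => exact ⟨rfl, rfl⟩
  | succ s hs ih =>
    rcases h.succ s with ⟨_, _, _, h4⟩ | ⟨_, _, h2, h3, h4⟩ | ⟨_, _, h2, h3, h4⟩
    · exact absurd h4 (hm s hs)
    · simp [symbolCount, h3, h4, h2, ih.2]; omega
    · simp [symbolCount, h3, h4, h2, ih.2]; omega

set_option linter.unnecessarySeqFocus false in
-- No mark occurs from position `m` on, so `ℓ` is constant from the stage that prints symbol `m`.
-- The bits after that position carry exactly the numbers given by `count`, and each was printed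
-- under the guard `count s < P s`.
theorem exists_of_name (h : RevisingOutput ℓ P o last count e) {y : BinSeq}
    (hK : ∀ K, ∃ s, K ≤ symbolCount e s) {m : ℕ}
    (hm : ∀ s k v, e s = some v → symbolCount e s = m + k → v = some (y k))
    (hm' : ∀ s v, e s = some v → m = symbolCount e s + 1 → v = none) :
    ∃ s₀ L, (∀ s ≥ s₀, ℓ s = L) ∧ ∀ k, ∃ s ≥ s₀, k ≤ s ∧ k < P s ∧ y k = o s k := by
  have nomark : ∀ s, m ≤ symbolCount e s → e s ≠ some none := by
    intro s hs he
    have := hm s (symbolCount e s - m) none he (by omega)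
    cases this
  -- The difference is the position just after the last mark printed so far, or `0` if there is
  -- none.
  have offset_mono : Monotone fun s => symbolCount e s - count s := by
    refine monotone_nat_of_le_succ fun s => ?_
    rcases h.succ s with ⟨_, _, h3, h4⟩ | ⟨_, _, _, h3, h4⟩ | ⟨_, _, _, h3, h4⟩ <;>
      simp [symbolCount, h3, h4] <;> omega
  have offset_le : ∀ s, symbolCount e s - count s ≤ m := by
    intro s
    induction s with
    | zero => simp [symbolCount]
    | succ s ih =>
      rcases h.succ s with ⟨_, _, h3, h4⟩ | ⟨_, _, _, h3, h4⟩ | ⟨_, _, _, h3, h4⟩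
      · have : symbolCount e s < m := lt_of_not_ge fun h' => nomark s h' h4
        simp [symbolCount, h3, h4]; omega
      · simp [symbolCount, h3, h4]; omega
      · simp [symbolCount, h3, h4]; omega
  -- If `m` is positive, symbol `m - 1` is a mark, which raises the offset to `m`; no later mark can
  -- raise it further.
  have offset_eq : ∀ s, m ≤ symbolCount e s → symbolCount e s = m + count s := by
    intro s hs
    have h1 := offset_le s
    have h2 := h.count_le s
    rcases Nat.eq_zero_or_pos m with h0 | h0
    · omega
    · obtain ⟨s', v, hv, hs'⟩ := exists_symbolCount_eq hK (m - 1)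
      obtain rfl := hm' s' v hv (by omega)
      have h3 : s' + 1 ≤ s := Nat.succ_le_of_lt (lt_of_not_ge fun h' => by
        have := symbolCount_mono e h'
        omega)
      have h4 := offset_mono h3
      simp only at h4
      rcases h.succ s' with ⟨_, _, h5, _⟩ | ⟨_, _, _, _, h6⟩ | ⟨_, _, _, _, h6⟩
      · have : symbolCount e (s' + 1) = m := by simp [symbolCount, hv]; omega
        omega
      · rw [hv] at h6; cases h6
      · rw [hv] at h6; cases h6
  obtain ⟨s₀, v₀, hv₀, hs₀⟩ := exists_symbolCount_eq hK m
  have late : ∀ s ≥ s₀, m ≤ symbolCount e s := fun s hs => hs₀ ▸ symbolCount_mono e hs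
  have stable : ∀ s ≥ s₀, ℓ s = last s₀ := by
    intro s hs
    rw [← (h.symbolCount_add_eq (fun s hs => nomark s (late s hs)) hs).2]
    rcases h.succ s with ⟨_, _, _, h4⟩ | ⟨h1, _⟩ | ⟨h1, _⟩
    · exact absurd h4 (nomark s (late s hs))
    · exact h1
    · exact h1
  refine ⟨s₀, last s₀, stable, fun k => ?_⟩
  obtain ⟨s, v, hv, hs⟩ := exists_symbolCount_eq hK (m + k)
  have hle : s₀ ≤ s := le_of_not_gt fun h' => by
    have := symbolCount_lt hv h'
    omega
  have hcount := offset_eq s (by omega)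
  have hck : count s = k := by omega
  refine ⟨s, hle, ?_, ?_⟩
  · have : ∀ s, symbolCount e s ≤ s := by
      intro s
      induction s with
      | zero => rfl
      | succ s ih => simp only [symbolCount]; split_ifs <;> omega
    have := this s
    omega
  · obtain rfl := hm s k v hv hs
    rcases h.succ s with ⟨_, _, _, h4⟩ | ⟨_, h2, _, _, h4⟩ | ⟨_, _, _, _, h4⟩
    · rw [hv] at h4; cases h4
    · rw [hv, hck] at h4
      exact ⟨hck ▸ h2, Option.some.inj (Option.some.inj h4)⟩
    · rw [hv] at h4; cases h4

/-- The output counted is what follows the last mark, and this may begin before `s₀`. Therefore `hw`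
is required for every stage from which `ℓ` has its limit value, not merely for a sufficiently late
one. -/
theorem name_of_stable (h : RevisingOutput ℓ P o last count e) {w : BinSeq} {s₀ : ℕ} {L : Λ}
    (hL : ∀ s ≥ s₀, ℓ s = L) (hK : ∀ K, ∃ᶠ s in atTop, K ≤ P s)
    (hw : ∀ s₁, (∀ s ≥ s₁, ℓ s = L) → ∀ s ≥ s₁, ∀ k < P s, o s k = w k) :
    (∀ K, ∃ s, K ≤ symbolCount e s) ∧ ∃ m,
      (∀ s k v, e s = some v → symbolCount e s = m + k → v = some (w k)) ∧
      ∀ s v, e s = some v → m = symbolCount e s + 1 → v = none := by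
  classical
  have last_succ : ∀ s, last (s + 1) = ℓ s := by
    intro s
    rcases h.succ s with ⟨_, h2, _⟩ | ⟨h1, _, h2, _⟩ | ⟨h1, _, h2, _⟩
    · exact h2
    · rw [h1, h2]
    · rw [h1, h2]
  have hex : ∃ s₁, ∀ s ≥ s₁, e s ≠ some none := by
    refine ⟨s₀ + 1, fun s hs he => ?_⟩
    obtain ⟨s, rfl⟩ := Nat.exists_eq_add_of_le' hs
    rcases h.succ (s + (s₀ + 1)) with ⟨h1, _⟩ | ⟨_, _, _, _, h4⟩ | ⟨_, _, _, _, h4⟩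
    · refine h1 ?_
      rw [← Nat.add_assoc, last_succ, hL _ (by omega), hL _ (by omega)]
    · rw [he] at h4; cases h4
    · rw [he] at h4; cases h4
  -- The least such `s₁` is the stage just after the last mark, or `0`, so `count s₁ = 0` and the
  -- numbering of the bits starts there.
  obtain ⟨s₁, hs₁, hmin⟩ : ∃ s₁, (∀ s ≥ s₁, e s ≠ some none) ∧
      ∀ s' < s₁, ¬ ∀ s ≥ s', e s ≠ some none :=
    ⟨Nat.find hex, Nat.find_spec hex, fun _ => Nat.find_min hex⟩
  have hpred : ∀ s', s₁ = s' + 1 → e s' = some none := by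
    rintro s' rfl
    by_contra hne
    refine hmin s' (Nat.lt_succ_self _) fun s hs => ?_
    rcases Nat.eq_or_lt_of_le hs with rfl | h'
    · exact hne
    · exact hs₁ s h'
  have hcount₁ : count s₁ = 0 := by
    rcases s₁ with _ | s'
    · exact h.zero
    · have he := hpred s' rfl
      rcases h.succ s' with ⟨_, _, h3, _⟩ | ⟨_, _, _, _, h4⟩ | ⟨_, _, _, _, h4⟩
      · exact h3
      · rw [he] at h4; cases h4
      · rw [he] at h4; cases h4
  have hℓ : ∀ s ≥ s₁, ℓ s = last s₁ := by
    intro s hs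
    rw [← (h.symbolCount_add_eq hs₁ hs).2]
    rcases h.succ s with ⟨_, _, _, h4⟩ | ⟨h1, _⟩ | ⟨h1, _⟩
    · exact absurd h4 (hs₁ s hs)
    · exact h1
    · exact h1
  have hL₁ : last s₁ = L := by
    rw [← hℓ (max s₀ s₁) (le_max_right _ _), hL _ (le_max_left _ _)]
  have hbit := hw s₁ fun s hs => (hℓ s hs).trans hL₁
  refine ⟨fun K => ?_, symbolCount e s₁, fun s k v hv hs => ?_, fun s v hv hs => ?_⟩
  · have : ∀ K, ∃ s ≥ s₁, K ≤ symbolCount e s := by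
      intro K
      induction K with
      | zero => exact ⟨s₁, le_rfl, Nat.zero_le _⟩
      | succ K ih =>
        obtain ⟨s, hs, hKs⟩ := ih
        obtain ⟨s', hP, hs'⟩ := ((hK (count s + 1)).and_eventually (eventually_ge_atTop s)).exists
        have h1 := (h.symbolCount_add_eq hs₁ hs).1
        have h2 := (h.symbolCount_add_eq hs₁ (hs.trans hs')).1
        have h3 := symbolCount_mono e hs'
        rcases h.succ s' with ⟨_, _, _, h4⟩ | ⟨_, _, _, _, h4⟩ | ⟨_, h5, _⟩
        · exact absurd h4 (hs₁ _ (hs.trans hs'))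
        · exact ⟨s' + 1, by omega, by simp [symbolCount, h4]; omega⟩
        · exact ⟨s', by omega, by omega⟩
    obtain ⟨s, _, hs⟩ := this K
    exact ⟨s, hs⟩
  · have hle : s₁ ≤ s := le_of_not_gt fun h' => by
      have := symbolCount_lt hv h'
      omega
    have h1 := (h.symbolCount_add_eq hs₁ hle).1
    have hck : count s = k := by omega
    rcases h.succ s with ⟨_, _, _, h4⟩ | ⟨_, h2, _, _, h4⟩ | ⟨_, _, _, _, h4⟩
    · exact absurd h4 (hs₁ s hle)
    · rw [hv, hck] at h4
      rw [Option.some.inj h4, hbit s hle k (hck ▸ h2)]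
    · rw [hv] at h4; cases h4
  · rcases hs₁' : s₁ with _ | s'
    · rw [hs₁'] at hs
      simp [symbolCount] at hs
    · have he := hpred s' hs₁'
      have : symbolCount e s' = symbolCount e s := by
        rw [hs₁'] at hs
        simp [symbolCount, he] at hs
        exact hs
      obtain rfl := eq_of_symbolCount_eq he hv this
      rw [hv] at he
      exact Option.some.inj he

end RevisingOutput

/-! ### The approximate computation on finite data -/

namespace FiniteSim

/-- The four tapes, given by finite lists (continued by `0`), with the positions of their heads. The
last one is the output tape. -/
abbrev Tapes : Type := Fin 4 → List Bool × ℕ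

def readCell (p : List Bool × ℕ) : Bool := p.1.getD p.2 false

/-- The new length exceeds both the old length and the head position, so no stored cell is lost and
the written one is present. -/
def writeCell (p : List Bool × ℕ) (b : Bool) : List Bool × ℕ :=
  ((List.range (p.1.length + p.2 + 1)).map fun k => if k = p.2 then b else p.1.getD k false,
    p.2 + 1)

theorem getD_writeCell (p : List Bool × ℕ) (b : Bool) (k : ℕ) :
    (writeCell p b).1.getD k false = Function.update (fun k => p.1.getD k false) p.2 b k := by
  unfold writeCell
  by_cases hk : k < p.1.length + p.2 + 1
  · rw [List.getD_eq_getElem _ _ (by simpa using hk)]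
    by_cases h : k = p.2
    · subst h; simp
    · simp [h]
  · rw [List.getD_eq_default _ _ (by simpa using hk), Function.update_of_ne (by omega),
      List.getD_eq_default _ _ (by omega)]

variable {V : Type}

/-- One step at a vertex whose label is not `?`. -/
def step (a : Instr V) (c : V × Tapes) : V × Tapes :=
  match a with
  | .start v => (v, c.2)
  | .test i u v => (if readCell (c.2 i.castSucc) = true then v else u, c.2)
  | .left i v =>
      if (c.2 i.castSucc).2 = 0 then c
      else (v, Function.update c.2 i.castSucc ((c.2 i.castSucc).1, (c.2 i.castSucc).2 - 1))
  | .right i v =>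
      (v, Function.update c.2 i.castSucc ((c.2 i.castSucc).1, (c.2 i.castSucc).2 + 1))
  | .write i b v => (v, Function.update c.2 i.succ.castSucc (writeCell (c.2 i.succ.castSucc) b))
  | .writeOut b v => (v, Function.update c.2 3 (writeCell (c.2 3) b))
  | .query _ _ => c
  | .accept => c
  | .reject => c

/-- One step, in which queries are answered by `ask`. -/
def simStep (ask : V × Tapes → Option ((ℕ × Bool) × ℕ)) (a : Instr V)
    (r : (V × Tapes) × OracleMachine.CallLog × ℕ) : (V × Tapes) × OracleMachine.CallLog × ℕ :=
  match a with
  | .query v₀ v₁ =>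
    Option.casesOn (ask (v₁, Function.update r.1.2 3 ([], 0))) r
      fun e => ((v₀, Function.update r.1.2 2 (if e.1.2 = true then [true] else [], 0)),
        e.1 :: r.2.1, min r.2.2 e.2)
  | a => (step a r.1, r.2)

def hasOne (p : List Bool × ℕ) : Bool := decide (∃ k ∈ List.range p.2, p.1.getD k false = true)

def simResult (acc : V → Bool) (s : ℕ) (r : (V × Tapes) × OracleMachine.CallLog × ℕ) :
    (ℕ × Bool) × ℕ :=
  ((Encodable.encode r.2.1, hasOne (r.1.2 3)),
    min r.2.2 (if acc r.1.1 = true then s else (r.1.2 3).2))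

def ask (node : V → Instr V) (acc : V → Bool) : ℕ → ℕ → V × Tapes → Option ((ℕ × Bool) × ℕ)
  | 0, _, _ => none
  | m + 1, s, c =>
    some (simResult acc s ((fun r => simStep (ask node acc m s) (node r.1.1) r)^[s] (c, [], s)))

def sim (node : V → Instr V) (acc : V → Bool) (m s t : ℕ) (c : V × Tapes) :
    (V × Tapes) × OracleMachine.CallLog × ℕ :=
  (fun r => simStep (ask node acc m s) (node r.1.1) r)^[t] (c, [], s)

section Primrec

theorem primrec_readCell : Primrec readCell := (Primrec.list_getD false).comp .fst .snd

theorem primrec_writeCell (b : Bool) : Primrec fun p => writeCell p b := by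
  refine Primrec.pair (Primrec.list_map (Primrec.list_range.comp (Primrec.succ.comp
    (Primrec.nat_add.comp (Primrec.list_length.comp .fst) .snd))) ?_) (Primrec.succ.comp .snd)
  exact Primrec.ite (Primrec.eq.comp .snd (Primrec.snd.comp .fst)) (.const b)
    ((Primrec.list_getD false).comp (Primrec.fst.comp .fst) .snd)

variable {α : Type*} [Primcodable α]

theorem primrec_tape {f : α → Tapes} (hf : Primrec f) (i : Fin 4) : Primrec fun a => f a i :=
  Primrec.fin_app.comp hf (.const i)

theorem primrec_update {f : α → Tapes} {g : α → List Bool × ℕ} (hf : Primrec f) (hg : Primrec g)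
    (i : Fin 4) : Primrec fun a => Function.update (f a) i (g a) := by
  refine Primrec.fin_curry.2 ?_
  have : Primrec fun p : α × Fin 4 => if p.2 = i then g p.1 else f p.1 p.2 :=
    Primrec.ite (Primrec.eq.comp .snd (.const i)) (hg.comp .fst)
      (Primrec.fin_app.comp (hf.comp .fst) .snd)
  exact this.of_eq fun p => by simp [Function.update_apply]

/-- Case distinction over a finite type: all values `F v b` are listed in a vector, from which the
entry for `f b` is selected. -/
theorem primrec_of_finite {V : Type*} [Finite V] [Primcodable V] {β σ : Type*} [Primcodable β]
    [Primcodable σ] {F : V → β → σ} (h : ∀ v, Primrec (F v)) {f : β → V} (hf : Primrec f) :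
    Primrec fun b => F (f b) b := by
  obtain ⟨k, ⟨e⟩⟩ := Finite.exists_equiv_fin V
  have h1 : Primrec fun b => List.Vector.ofFn fun i => F (e.symm i) b :=
    Primrec.vector_ofFn fun i => h (e.symm i)
  refine (Primrec.vector_get.comp h1 ((Primrec.dom_finite e).comp hf)).of_eq fun b => ?_
  simp

theorem primrec_hasOne : Primrec hasOne := by
  have h : PrimrecRel fun (k : ℕ) (l : List Bool) => l.getD k false = true :=
    Primrec.eq.comp ((Primrec.list_getD false).comp .snd .fst) (.const true)
  exact (h.exists_mem_list.comp (Primrec.list_range.comp .snd) .fst).decide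

variable [Primcodable V]

theorem primrec_step (a : Instr V) : Primrec (step a) := by
  have tape : ∀ i, Primrec fun c : V × Tapes => c.2 i := primrec_tape .snd
  cases a with
  | start v => exact Primrec.pair (.const v) .snd
  | test i u v =>
    exact Primrec.pair (Primrec.ite (Primrec.eq.comp (primrec_readCell.comp (tape _)) (.const true))
      (.const v) (.const u)) .snd
  | left i v =>
    exact Primrec.ite (Primrec.eq.comp (Primrec.snd.comp (tape _)) (.const 0)) .id
      (Primrec.pair (.const v) (primrec_update .snd (Primrec.pair (Primrec.fst.comp (tape _))
        (Primrec.pred.comp (Primrec.snd.comp (tape _)))) _))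
  | right i v =>
    exact Primrec.pair (.const v) (primrec_update .snd (Primrec.pair (Primrec.fst.comp (tape _))
      (Primrec.succ.comp (Primrec.snd.comp (tape _)))) _)
  | write i b v =>
    exact Primrec.pair (.const v) (primrec_update .snd ((primrec_writeCell b).comp (tape _)) _)
  | writeOut b v =>
    exact Primrec.pair (.const v) (primrec_update .snd ((primrec_writeCell b).comp (tape _)) _)
  | query _ _ => exact .id
  | accept => exact .id
  | reject => exact .id

theorem primrec_simStep {ask : ℕ → V × Tapes → Option ((ℕ × Bool) × ℕ)} (hask : Primrec₂ ask)
    (a : Instr V) :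
    Primrec fun p : ℕ × ((V × Tapes) × OracleMachine.CallLog × ℕ) =>
      simStep (ask p.1) a p.2 := by
  have plain : Primrec fun p : ℕ × ((V × Tapes) × OracleMachine.CallLog × ℕ) =>
      (step a p.2.1, p.2.2) :=
    Primrec.pair ((primrec_step a).comp (Primrec.fst.comp .snd)) (Primrec.snd.comp .snd)
  cases a with
  | query v₀ v₁ =>
    have tapes : Primrec fun p : ℕ × ((V × Tapes) × OracleMachine.CallLog × ℕ) => p.2.1.2 :=
      Primrec.snd.comp (Primrec.fst.comp .snd)
    refine Primrec.option_casesOn (hask.comp .fst (Primrec.pair (.const v₁)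
      (primrec_update tapes (.const ([], 0)) 3))) .snd ?_
    refine Primrec.pair (Primrec.pair (.const v₀) (primrec_update (tapes.comp .fst)
      (Primrec.pair (Primrec.ite (Primrec.eq.comp (Primrec.snd.comp (Primrec.fst.comp .snd))
        (.const true)) (.const [true]) (.const [])) (.const 0)) 2)) ?_
    have rest : Primrec fun q : (ℕ × ((V × Tapes) × OracleMachine.CallLog × ℕ)) ×
        ((ℕ × Bool) × ℕ) => q.1.2.2 := Primrec.snd.comp (Primrec.snd.comp .fst)
    exact Primrec.pair (Primrec.list_cons.comp (Primrec.fst.comp .snd) (Primrec.fst.comp rest))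
      (Primrec.nat_min.comp (Primrec.snd.comp rest) (Primrec.snd.comp .snd))
  | _ => exact plain

variable [Finite V]

theorem primrec_simResult (acc : V → Bool) :
    Primrec fun p : ℕ × ((V × Tapes) × OracleMachine.CallLog × ℕ) =>
      simResult acc p.1 p.2 := by
  have tape : Primrec fun p : ℕ × ((V × Tapes) × OracleMachine.CallLog × ℕ) => p.2.1.2 3 :=
    primrec_tape (Primrec.snd.comp (Primrec.fst.comp .snd)) 3
  refine Primrec.pair (Primrec.pair (Primrec.encode.comp (Primrec.fst.comp (Primrec.snd.comp .snd)))
    (primrec_hasOne.comp tape)) (Primrec.nat_min.comp (Primrec.snd.comp (Primrec.snd.comp .snd)) ?_)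
  exact Primrec.ite (Primrec.eq.comp ((Primrec.dom_finite acc).comp
    (Primrec.fst.comp (Primrec.fst.comp .snd))) (.const true)) .fst (Primrec.snd.comp tape)

theorem primrec_iterate_simStep {ask : ℕ → V × Tapes → Option ((ℕ × Bool) × ℕ)}
    (hask : Primrec₂ ask) (node : V → Instr V) :
    Primrec fun p : ℕ × (V × Tapes) =>
      (fun r => simStep (ask p.1) (node r.1.1) r)^[p.1]
        ((p.2, [], p.1) : (V × Tapes) × OracleMachine.CallLog × ℕ) := by
  refine Primrec.nat_iterate .fst (Primrec.pair .snd (Primrec.pair (.const []) .fst)) ?_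
  have h := primrec_of_finite (F := fun v (p : ℕ × ((V × Tapes) × OracleMachine.CallLog × ℕ)) =>
    simStep (ask p.1) (node v) p.2) (fun v => primrec_simStep hask (node v))
    (f := fun p => p.2.1.1) (Primrec.fst.comp (Primrec.fst.comp .snd))
  exact h.comp (Primrec.pair (Primrec.fst.comp .fst) .snd)

/-- The depth is fixed, so the recursion over it takes place outside the primitive recursive
functions; each level is an iteration over `s` steps that calls the level below. -/
theorem primrec_ask (node : V → Instr V) (acc : V → Bool) (m : ℕ) :
    Primrec₂ (ask node acc m) := by
  induction m with
  | zero => exact Primrec.const none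
  | succ m ih =>
    exact Primrec.option_some.comp ((primrec_simResult acc).comp
      (Primrec.pair .fst (primrec_iterate_simStep ih node)))

theorem primrec_sim (node : V → Instr V) (acc : V → Bool) (m : ℕ) :
    Primrec fun p : ℕ × (V × Tapes) => sim node acc m p.1 p.1 p.2 :=
  primrec_iterate_simStep (primrec_ask node acc m) node

end Primrec

/-- The finite data `c` describe the configuration `d`, except for the input tape from the cell with
number `B` on. -/
structure Describes (B : ℕ) (c : V × Tapes) (d : Config V) : Prop where
  q : c.1 = d.q
  head : ∀ i : Fin 3, (c.2 i.castSucc).2 = d.head i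
  tape : ∀ i : Fin 3, ∀ k, (i = 0 → k < B) → (c.2 i.castSucc).1.getD k false = d.tape i k
  outHead : (c.2 3).2 = d.outHead
  out : ∀ k, (c.2 3).1.getD k false = d.out k

theorem castSucc_ne_three (i : Fin 3) : i.castSucc ≠ (3 : Fin 4) := by
  intro h
  have := congrArg Fin.val h
  simp at this
  omega

variable {M : OracleMachine}

theorem Describes.step {B : ℕ} {c : M.V × Tapes} {d : Config M.V} (h : Describes B c d)
    (hB : d.head 0 < B) : Describes B (step (M.node d.q) c) ((M.next d).getD d) := by
  unfold FiniteSim.step OracleMachine.next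
  split
  · simp only [*]; exact ⟨rfl, h.head, h.tape, h.outHead, h.out⟩
  · rename_i i u v heq
    simp only [heq]
    have hr : readCell (c.2 i.castSucc) = d.tape i (d.head i) := by
      rw [readCell, h.head]
      exact h.tape i _ fun hi => by rw [hi]; exact hB
    refine ⟨?_, h.head, h.tape, h.outHead, h.out⟩
    simp [hr]
  · rename_i i v heq
    simp only [heq, h.head]
    split_ifs with h0
    · exact h
    · refine ⟨rfl, fun j => ?_, fun j k hk => ?_, ?_, ?_⟩
      · by_cases hj : j = i
        · subst hj; simp
        · simp [h.head, hj]
      · by_cases hj : j = i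
        · subst hj; simpa using h.tape j k hk
        · simpa [hj] using h.tape j k hk
      · simpa [Function.update_of_ne (castSucc_ne_three i).symm] using h.outHead
      · simpa [Function.update_of_ne (castSucc_ne_three i).symm] using h.out
  · rename_i i v heq
    simp only [heq, h.head]
    refine ⟨rfl, fun j => ?_, fun j k hk => ?_, ?_, ?_⟩
    · by_cases hj : j = i
      · subst hj; simp
      · simp [h.head, hj]
    · by_cases hj : j = i
      · subst hj; simpa using h.tape j k hk
      · simpa [hj] using h.tape j k hk
    · simpa [Function.update_of_ne (castSucc_ne_three i).symm] using h.outHead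
    · simpa [Function.update_of_ne (castSucc_ne_three i).symm] using h.out
  · rename_i i b v heq
    simp only [heq]
    -- Writing never affects the input tape, so on the tape written the description is exact in all
    -- cells.
    have hne := Fin.succ_ne_zero i
    generalize i.succ = i' at hne ⊢
    refine ⟨rfl, fun j => ?_, fun j k hk => ?_, ?_, ?_⟩
    · by_cases hj : j = i'
      · subst hj; simp [writeCell, h.head]
      · simp [h.head, hj]
    · by_cases hj : j = i'
      · subst hj
        have : (fun k => (c.2 j.castSucc).1.getD k false) = d.tape j :=
          funext fun k => h.tape _ k fun h0 => absurd h0 hne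
        simp only [Option.getD_some, Function.update_self]
        rw [getD_writeCell, this, h.head]
      · simpa [hj] using h.tape j k hk
    · simpa [Function.update_of_ne (castSucc_ne_three i').symm] using h.outHead
    · simpa [Function.update_of_ne (castSucc_ne_three i').symm] using h.out
  · rename_i b v heq
    simp only [heq]
    refine ⟨rfl, fun j => ?_, fun j k hk => ?_, ?_, fun k => ?_⟩
    · simpa [Function.update_of_ne (castSucc_ne_three j)] using h.head j
    · simpa [Function.update_of_ne (castSucc_ne_three j)] using h.tape j k hk
    · simp [writeCell, h.outHead]
    · have : (fun k => (c.2 3).1.getD k false) = d.out := funext h.out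
      simp only [Option.getD_some, Function.update_self]
      rw [getD_writeCell, this, h.outHead]
  all_goals simp only [*]; exact h

theorem Describes.spawn {B : ℕ} {c : M.V × Tapes} {d : Config M.V} (h : Describes B c d)
    (v : M.V) : Describes B (v, Function.update c.2 3 ([], 0)) (M.spawn d v) := by
  refine ⟨rfl, fun j => ?_, fun j k hk => ?_, by simp [OracleMachine.spawn], fun k => ?_⟩
  · simpa [OracleMachine.spawn, Function.update_of_ne (castSucc_ne_three j)] using h.head j
  · simpa [OracleMachine.spawn, Function.update_of_ne (castSucc_ne_three j)] using h.tape j k hk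
  · simp [OracleMachine.spawn, zeroSeq]

theorem Describes.receive {B : ℕ} {c : M.V × Tapes} {d : Config M.V} (h : Describes B c d)
    (v : M.V) (b : Bool) :
    Describes B (v, Function.update c.2 2 (if b = true then [true] else [], 0))
      (M.receive d v (OracleMachine.answerSeq b)) := by
  have h2 : (2 : Fin 4) = (2 : Fin 3).castSucc := rfl
  refine ⟨rfl, fun j => ?_, fun j k hk => ?_, ?_, ?_⟩
  · by_cases hj : j = 2
    · subst hj; simp [OracleMachine.receive, h2]
    · have h3 : j.castSucc ≠ 2 := fun h3 => hj (Fin.castSucc_injective _ h3)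
      simp [OracleMachine.receive, Function.update_of_ne h3, hj, h.head]
  · by_cases hj : j = 2
    · subst hj
      cases b <;> rcases k with _ | k <;>
        simp [OracleMachine.receive, h2, OracleMachine.answerSeq, zeroSeq, oneZeroSeq]
    · have h3 : j.castSucc ≠ 2 := fun h3 => hj (Fin.castSucc_injective _ h3)
      simpa [OracleMachine.receive, Function.update_of_ne h3, hj] using h.tape j k hk
  · exact h.outHead
  · exact h.out

theorem head_next_le (d : Config M.V) : ((M.next d).getD d).head 0 ≤ d.head 0 + 1 := by
  unfold OracleMachine.next
  split
  · simp
  · simp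
  · rename_i i v heq
    split_ifs
    · simp
    · by_cases hi : (0 : Fin 3) = i
      · subst hi; simp; omega
      · simp [Function.update_of_ne hi]
  · rename_i i v heq
    by_cases hi : (0 : Fin 3) = i
    · subst hi; simp
    · simp [Function.update_of_ne hi]
  · rename_i i b v heq
    simp [Function.update_of_ne (Fin.succ_ne_zero i).symm]
  all_goals simp

theorem simResult_eq {B : ℕ} {acc : M.V → Bool} (hacc : ∀ v, acc v = true ↔ M.node v = .accept)
    {s : ℕ} {r : (M.V × Tapes) × OracleMachine.CallLog × ℕ}
    {r' : Config M.V × OracleMachine.CallLog × ℕ} (h : Describes B r.1 r'.1) (h2 : r.2 = r'.2) :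
    simResult acc s r = OracleMachine.simResult s r' := by
  unfold simResult OracleMachine.simResult
  have h3 : hasOne (r.1.2 3) = OracleMachine.hasOne r'.1 := by
    unfold hasOne OracleMachine.hasOne
    rw [decide_eq_decide]
    simp only [List.mem_range, h.out, h.outHead]
  have h4 : acc r.1.1 = true ↔ M.node r'.1.q = .accept := by rw [hacc, h.q]
  rw [h2, h3, h.outHead]
  by_cases hn : M.node r'.1.q = .accept
  · rw [if_pos hn, if_pos (h4.2 hn)]
  · rw [if_neg hn, if_neg (h4.not.2 hn)]

/-- The approximate computation depends only on a finite part of the input. -/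
theorem describes_sim {acc : M.V → Bool} (hacc : ∀ v, acc v = true ↔ M.node v = .accept) {B : ℕ}
    (m : ℕ) : ∀ {s : ℕ} {c : M.V × Tapes} {d : Config M.V}, Describes B c d →
      d.head 0 + (m + 1) * s ≤ B → ∀ t ≤ s,
      Describes B (sim M.node acc m s t c).1 (M.sim m s t d).1 ∧
      (sim M.node acc m s t c).2 = (M.sim m s t d).2 ∧ (M.sim m s t d).1.head 0 ≤ d.head 0 + t := by
  induction m using Nat.strong_induction_on with
  | _ m ih =>
  intro s c d h hB t ht
  induction t with
  | zero => exact ⟨h, rfl, le_rfl⟩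
  | succ t iht =>
    obtain ⟨h1, h2, h3⟩ := iht (by omega)
    have hs : sim M.node acc m s (t + 1) c = simStep (ask M.node acc m s)
        (M.node (M.sim m s t d).1.q) (sim M.node acc m s t c) := by
      rw [← h1.q]
      exact Function.iterate_succ_apply' _ _ _
    rw [hs, OracleMachine.sim_succ]
    set r := sim M.node acc m s t c
    set r' := M.sim m s t d
    by_cases hq : ∃ v₀ v₁, M.node r'.1.q = .query v₀ v₁
    · obtain ⟨v₀, v₁, hq⟩ := hq
      rw [hq]
      rcases m with _ | m
      · rw [OracleMachine.simStep_query_zero hq]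
        exact ⟨h1, h2, by omega⟩
      · rw [OracleMachine.simStep_query_succ hq]
        have hres : ask M.node acc (m + 1) s (v₁, Function.update r.1.2 3 ([], 0)) =
            some (OracleMachine.simResult s (M.sim m s s (M.spawn r'.1 v₁))) := by
          -- A query inherits an input head moved by at most `t < s` cells, so each level of nesting
          -- costs at most `s` further cells of input.
          have hle : r'.1.head 0 + (m + 1) * s ≤ B := by
            have : (m + 1 + 1) * s = (m + 1) * s + s := by ring
            omega
          obtain ⟨h4, h5, _⟩ := ih m (Nat.lt_succ_self m) (h1.spawn v₁) hle s le_rfl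
          exact congrArg some (simResult_eq hacc h4 h5)
        simp only [simStep, hres, h2]
        exact ⟨h1.receive v₀ _, trivial, by
          have : (M.receive r'.1 v₀ (OracleMachine.answerSeq
            (OracleMachine.simResult s (M.sim m s s (M.spawn r'.1 v₁))).1.2)).head 0 =
              r'.1.head 0 := rfl
          omega⟩
    · push Not at hq
      have hplain : simStep (ask M.node acc m s) (M.node r'.1.q) r =
          (step (M.node r'.1.q) r.1, r.2) := by
        unfold simStep
        split
        · exact absurd ‹_› (hq _ _)
        · rfl
      rw [hplain, OracleMachine.simStep_of_not_query hq]
      refine ⟨h1.step ?_, h2, ?_⟩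
      · have : (m + 1) * s = m * s + s := by ring
        omega
      · have := head_next_le r'.1
        simp only
        omega

end FiniteSim

/-! ### The finitely revising computation -/

namespace FiniteSim

/-- The initial finite data on an input with the prefix `u`. -/
def init {V : Type} (start : V) (u : List Bool) : V × Tapes :=
  (start, fun i => if i = 0 then (u, 0) else ([], 0))

theorem describes_init (M : OracleMachine) (x : BinSeq) (s : ℕ) :
    Describes s (init M.start ((List.range s).map x)) (M.init x) := by
  refine ⟨rfl, fun i => ?_, fun i k hk => ?_, rfl, fun k => rfl⟩
  · fin_cases i <;> rfl
  · fin_cases i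
    · have := hk rfl
      simp [init, OracleMachine.init, this]
    · rfl
    · rfl

/-- The state of the revising computation: the part of the input that has been read, the calls on
which the current output is based, the number of bits since the last mark, and the symbol produced
last. -/
abbrev RevState : Type := List Bool × OracleMachine.CallLog × ℕ × Option (Option Bool)

/-- One stage of the revising computation. -/
def revise (sm : List Bool → (Tapes × OracleMachine.CallLog) × ℕ) (b : Bool) (a : RevState) :
    RevState :=
  (a.1 ++ [b],
    if (sm a.1).1.2 = a.2.1 then
      if a.2.2.1 < (sm a.1).2 then
        (a.2.1, a.2.2.1 + 1, some (some (((sm a.1).1.1 3).1.getD a.2.2.1 false)))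
      else (a.2.1, a.2.2.1, none)
    else ((sm a.1).1.2, 0, some none))

theorem primrec_revise {sm : List Bool → (Tapes × OracleMachine.CallLog) × ℕ} (h : Primrec sm)
    (b : Bool) : Primrec (revise sm b) := by
  have hs : Primrec fun a : RevState => sm a.1 := h.comp .fst
  have last : Primrec fun a : RevState => a.2.1 := Primrec.fst.comp .snd
  have count : Primrec fun a : RevState => a.2.2.1 := Primrec.fst.comp (Primrec.snd.comp .snd)
  have log : Primrec fun a : RevState => (sm a.1).1.2 := Primrec.snd.comp (Primrec.fst.comp hs)
  refine Primrec.pair (Primrec.list_concat.comp .fst (.const b)) ?_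
  refine Primrec.ite (Primrec.eq.comp log last) ?_ (Primrec.pair log (.const (0, some none)))
  refine Primrec.ite (Primrec.nat_lt.comp count (Primrec.snd.comp hs)) ?_
    (Primrec.pair last (Primrec.pair count (.const none)))
  refine Primrec.pair last (Primrec.pair (Primrec.succ.comp count) ?_)
  exact Primrec.option_some.comp (Primrec.option_some.comp ((Primrec.list_getD false).comp
    (Primrec.fst.comp (primrec_tape (Primrec.fst.comp (Primrec.fst.comp hs)) 3)) count))

end FiniteSim

open FiniteSim in
theorem theorem27 (M : OracleMachine) (n : ℕ) :
    FinitelyRevisingComputable (fun x =>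
      {y | y ∈ M.depthFun (fun w => {LPO w}) n x ∧
        M.FinitelyManyCalls (fun w => {LPO w}) n x}) := by
  classical
  have := M.finite
  obtain ⟨k, ⟨eqv⟩⟩ := Finite.exists_equiv_fin M.V
  let _ : Primcodable M.V := Primcodable.ofEquiv (Fin k) eqv
  let acc : M.V → Bool := fun v => decide (M.node v = .accept)
  have hacc : ∀ v, acc v = true ↔ M.node v = .accept := fun v => decide_eq_true_iff
  -- Depth `n` with budget `s` needs at most `(n + 1) * s` input cells, so a prefix of length `ℓ`
  -- permits the budget `ℓ / (n + 1)`.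
  let fs : List Bool → (M.V × Tapes) × OracleMachine.CallLog × ℕ := fun u =>
    sim M.node acc n (u.length / (n + 1)) (u.length / (n + 1)) (FiniteSim.init M.start u)
  let sm : List Bool → (Tapes × OracleMachine.CallLog) × ℕ := fun u =>
    (((fs u).1.2, (fs u).2.1), (simResult acc (u.length / (n + 1)) (fs u)).2)
  have len : Primrec fun u : List Bool => u.length / (n + 1) :=
    Primrec.nat_div.comp Primrec.list_length (.const _)
  have hinit : Primrec fun u : List Bool => FiniteSim.init M.start u := by
    refine Primrec.pair (.const _) (Primrec.fin_curry.2 ?_)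
    exact Primrec.ite (Primrec.eq.comp .snd (.const 0)) (Primrec.pair .fst (.const 0))
      (.const ([], 0))
  have hfs : Primrec fs := (primrec_sim M.node acc n).comp (Primrec.pair len hinit)
  have hsm : Primrec sm := Primrec.pair (Primrec.pair (Primrec.snd.comp (Primrec.fst.comp hfs))
    (Primrec.fst.comp (Primrec.snd.comp hfs)))
    (Primrec.snd.comp ((primrec_simResult acc).comp (Primrec.pair len hfs)))
  obtain ⟨R, hR, H⟩ := exists_revising_stageMachine (([], [], 0, none) : RevState) (revise sm)
    (primrec_revise hsm) (fun a => a.2.2.2)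
    (Primrec.snd.comp (Primrec.snd.comp Primrec.snd))
  refine ⟨R, hR, fun x => Set.ext fun y => ?_⟩
  let st : ℕ → RevState := stageState (revise sm) ([], [], 0, none) x
  let r : ℕ → Config M.V × OracleMachine.CallLog × ℕ := fun s => M.sim n s s (M.init x)
  have hst : ∀ s, (st s).1 = (List.range s).map x := by
    intro s
    induction s with
    | zero => rfl
    | succ s ih =>
      have : (st (s + 1)).1 = (st s).1 ++ [x s] := rfl
      rw [this, ih, List.range_succ, List.map_append, List.map_singleton]
  have hsim : ∀ s, Describes s (fs (st s).1).1 (r (s / (n + 1))).1 ∧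
      (fs (st s).1).2 = (r (s / (n + 1))).2 := by
    intro s
    have hle : (M.init x).head 0 + (n + 1) * (s / (n + 1)) ≤ s := by
      have : (M.init x).head 0 = 0 := rfl
      rw [this, Nat.zero_add]
      exact Nat.mul_div_le s (n + 1)
    have := describes_sim hacc n (describes_init M x s) hle _ le_rfl
    rw [hst]
    simp only [fs, List.length_map, List.length_range]
    exact ⟨this.1, this.2.1⟩
  have hout : RevisingOutput (fun s => (r (s / (n + 1))).2.1)
      (fun s => (OracleMachine.simResult (s / (n + 1)) (r (s / (n + 1)))).2)
      (fun s => (r (s / (n + 1))).1.out) (fun s => (st s).2.1) (fun s => (st s).2.2.1)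
      (fun s => (st (s + 1)).2.2.2) := by
    refine ⟨rfl, fun s => ?_⟩
    obtain ⟨h1, h2⟩ := hsim s
    have h3 := simResult_eq hacc (s := s / (n + 1)) h1 h2
    have h4 : (sm (st s).1).2 = (OracleMachine.simResult (s / (n + 1)) (r (s / (n + 1)))).2 := by
      rw [← h3]
      simp [sm, hst]
    have h5 : (sm (st s).1).1.2 = (r (s / (n + 1))).2.1 := congrArg Prod.fst h2
    have h6 : ∀ k, ((sm (st s).1).1.1 3).1.getD k false = (r (s / (n + 1))).1.out k := h1.out
    have hnext : st (s + 1) = revise sm (x s) (st s) := rfl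
    simp only [hnext, revise, h4, h5, h6]
    split_ifs with h7 h8
    · exact .inr (.inl ⟨h7, h8, rfl, rfl, rfl⟩)
    · exact .inr (.inr ⟨h7, not_lt.1 h8, rfl, rfl, rfl⟩)
    · exact .inl ⟨h7, rfl, rfl, rfl⟩
  have hT := OracleMachine.sequential_lpoStep (M := M) n
  have hdiv : Tendsto (fun s => s / (n + 1)) atTop atTop :=
    Nat.tendsto_div_const_atTop (Nat.succ_ne_zero n)
  -- Every budget occurs at a late enough stage, so stability over the stages is stability over the
  -- budgets, as `sim_correct` requires.
  have onto : ∀ s₁ j, s₁ / (n + 1) ≤ j → ∃ s ≥ s₁, s / (n + 1) = j := by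
    intro s₁ j hj
    refine ⟨s₁ % (n + 1) + (n + 1) * j, ?_, ?_⟩
    · have h1 := Nat.mod_add_div s₁ (n + 1)
      have h2 := Nat.mul_le_mul_left (n + 1) hj
      omega
    · rw [Nat.add_mul_div_left _ _ (Nat.succ_pos n),
        Nat.div_eq_of_lt (Nat.mod_lt _ (Nat.succ_pos n)), Nat.zero_add]
  -- once the calls are stable, the bits produced are those of the value
  have correct : ∀ s₁ L, (∀ s ≥ s₁, (r (s / (n + 1))).2.1 = L) →
      (∀ K, ∃ᶠ j in atTop, K ≤ (OracleMachine.simResult j (r j)).2) →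
      M.FinitelyManyCalls (fun w => {LPO w}) n x ∧
      ∃ w, w ∈ M.depthFun (fun w => {LPO w}) n x ∧ ∀ s ≥ s₁,
        ∀ k < (OracleMachine.simResult (s / (n + 1)) (r (s / (n + 1)))).2,
          (r (s / (n + 1))).1.out k = w k := by
    intro s₁ L hL hK
    obtain ⟨h1, ⟨w, hw⟩, h2⟩ := OracleMachine.sim_correct n (c := M.init x) (L := L)
      (s₀ := s₁ / (n + 1)) (fun j hj => by
        obtain ⟨s, hs, rfl⟩ := onto s₁ j hj
        exact hL s hs) hK
    refine ⟨h1, w, hw, fun s hs k hk => ?_⟩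
    have h3 := h2 (s / (n + 1)) (Nat.div_le_div_right hs) _ le_rfl
    change (r (s / (n + 1))).1 = _ at h3
    -- After acceptance the progress may exceed the position of the output head; all cells are then
    -- final. Otherwise `k` lies behind the head.
    by_cases ha : M.node (r (s / (n + 1))).1.q = .accept
    · rw [h3] at ha ⊢
      rcases (hT.yields_iff _ _).1 hw with ⟨t, ht, rfl⟩ | ⟨hK', _⟩
      · rcases le_total t (s / (n + 1)) with h | h
        · rw [hT.iterate_eq_of_accept h ht]
        · rw [hT.iterate_eq_of_accept h ha]
      · obtain ⟨t, ht⟩ := hK' (((OracleMachine.advance (M.LPOStep n))^[s / (n + 1)]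
          (M.init x)).outHead + 1)
        rcases le_total (s / (n + 1)) t with h | h
        · rw [hT.iterate_eq_of_accept h ha] at ht; omega
        · have := hT.outHead_mono (M.init x) h
          simp only at this
          omega
    · have hk' : k < (r (s / (n + 1))).1.outHead := by
        refine hk.trans_le ((min_le_right _ _).trans ?_)
        rw [if_neg ha]
      rw [h3] at hk' ⊢
      exact hT.out_eq_of_yields hw hk'
  rw [Set.mem_ofPred_eq, Set.mem_ofPred_eq, H x y _ fun s => rfl]
  constructor
  · rintro ⟨hy, hf⟩
    obtain ⟨L, hL, hK⟩ := OracleMachine.eventually_sim n hy hf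
    obtain ⟨s₀, hs₀⟩ := eventually_atTop.1 (hdiv.eventually (hL.mono fun _ h => h.2))
    refine hout.name_of_stable (L := L) hs₀ (fun K => (hdiv.eventually (hK K)).frequently)
      fun s₁ hs₁ s hs k hk => ?_
    obtain ⟨_, w, hw, hbits⟩ := correct s₁ L hs₁ fun K => (hK K).frequently
    rw [hT.eq_of_yields hy hw]
    exact hbits s hs k hk
  · rintro ⟨hK, m, hm, hm'⟩
    obtain ⟨s₀, L, hL, hbits⟩ := hout.exists_of_name hK hm hm'
    obtain ⟨hf, w, hw, hw'⟩ := correct s₀ L hL fun K => by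
      rw [frequently_atTop]
      intro j
      -- The bit with this number is printed only with progress above `K`, and only at a stage whose
      -- budget is at least `j`.
      obtain ⟨s, _, hs, hP, _⟩ := hbits (max K (j * (n + 1)))
      refine ⟨s / (n + 1), ?_, ((le_max_left _ _).trans hP.le)⟩
      exact (Nat.le_div_iff_mul_le (Nat.succ_pos n)).2 ((le_max_right _ _).trans hs)
    have : y = w := by
      funext k
      obtain ⟨s, hs, _, hP, hyk⟩ := hbits k
      rw [hyk]
      exact hw' s hs k hP
    exact ⟨this ▸ hw, hf⟩
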